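/- All graphs are finite, simple, undirected and connected. A vertex $w$ of $G$ strongly resolves two vertices $u,v$ if some shortest path between $w$ and $u$ contains $v$, or some shortest path between $w$ and $v$ contains $u$. The strong metric dimension $\mathrm{smd}(G)$ is the smallest size of a set $R\subseteq V(G)$ such that every pair of distinct vertices is strongly resolved by some $w\in R$. Co-graphs are the graphs obtained from single vertices by disjoint unions and joins. A canonical co-tree of a co-graph $G$ is a rooted tree whose leaves are in bijection with $V(G)$, whose inner nodes are labelled $\cup$ or $\times$ and have at least two children, whose labels alternate on every path from the root to a leaf, and which describes $G$ by unions at the $\cup$-nodes and joins at the $\times$-nodes. Two distinct vertices are true twins if they have the same closed neighbourhood. **Theorem.** The strong metric dimension of connected undirected co-graphs can be computed in linear time. That is, there are a program $P$ for a random access machine (scalar variables and arrays of words; constants, copying, addition, truncated subtraction, indirect reading and writing, comparisons; each operation takes one step) and a constant $c$ such that, for every connected co-graph $G$ with vertex set $\{0,\dots,n-1\}$ and $m$ edges, given by adjacency lists in any order, $P$ halts after at most $c\,(n+m)$ steps with output $\mathrm{smd}(G)$, and no constant or sum that it forms exceeds $c\,(n+m)$. Moreover, every connected co-graph $G$ on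 $n$ vertices has a canonical co-tree, and for every canonical co-tree $T$ of $G$ $$\mathrm{smd}(G)=n-\mu(T),$$ where $\mu$ is computed bottom-up: $\mu$ of a single leaf is $1$; $\mu$ at a $\cup$-node is the maximum of $\mu$ over its subtrees; $\mu$ at a $\times$-node is the sum of $\mu$ over its subtrees that are not leaves, plus $1$ if at least one of its children is a leaf. Given $T$, the recursive procedure that computes $n-\mu(T)$ in this way takes $O(n)$ steps, with a constant that does not depend on $G$ or $T$. The number $\mu(T)$ is the size of a maximum clique in every graph obtained from $G$ by successively deleting vertices that have a true twin until no true twins are left. -/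

import Mathlib

/-! ## Strong metric dimension -/

/-- `w` strongly resolves `u` and `v`: some shortest path between `w` and `u` contains `v`, or
some shortest path between `w` and `v` contains `u`. -/
def StronglyResolves {V : Type*} (G : SimpleGraph V) (w u v : V) : Prop :=
  (∃ p : G.Walk w u, p.IsPath ∧ p.length = G.dist w u ∧ v ∈ p.support) ∨
  (∃ p : G.Walk w v, p.IsPath ∧ p.length = G.dist w v ∧ u ∈ p.support)

/-- Every pair of (distinct) vertices is strongly resolved by some vertex of `R`. -/
def IsStrongResolvingSet {V : Type*} (G : SimpleGraph V) (R : Finset V) : Prop :=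
  ∀ u v : V, u ≠ v → ∃ w ∈ R, StronglyResolves G w u v

/-- The size of a smallest strong resolving set (one exists when `G` is finite and connected,
since the set of all vertices is one). -/
noncomputable def strongMetricDim {V : Type*} (G : SimpleGraph V) : ℕ :=
  sInf {k | ∃ R : Finset V, IsStrongResolvingSet G R ∧ R.card = k}

/-! ## Co-graphs -/

/-- `CographOn G A`: the subgraph of `G` induced by the vertex set `A` is built from single
vertices by disjoint union and join. -/
inductive CographOn {V : Type*} (G : SimpleGraph V) : Set V → Prop
  | single (v : V) : CographOn G {v}
  | union (A B : Set V) : CographOn G A → CographOn G B → Disjoint A B →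
      (∀ a ∈ A, ∀ b ∈ B, ¬ G.Adj a b) → CographOn G (A ∪ B)
  | join (A B : Set V) : CographOn G A → CographOn G B → Disjoint A B →
      (∀ a ∈ A, ∀ b ∈ B, G.Adj a b) → CographOn G (A ∪ B)

/-- `G` is an undirected co-graph. -/
def IsCograph {V : Type*} (G : SimpleGraph V) : Prop := CographOn G Set.univ

/-! ## True twins -/

/-- `u` and `v` are true twins: distinct vertices with the same closed neighbourhood
(in particular they are adjacent). -/
def TrueTwins {V : Type*} (G : SimpleGraph V) (u v : V) : Prop :=
  u ≠ v ∧ insert u (G.neighborSet u) = insert v (G.neighborSet v)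

/-- `G[S]` is obtained from `G` by successively deleting vertices, each of which has a true twin
in the graph from which it is deleted. -/
inductive TwinDeletion {V : Type*} (G : SimpleGraph V) : Set V → Prop
  | start : TwinDeletion G Set.univ
  | delete (S : Set V) (u v : S) : TwinDeletion G S → TrueTwins (G.induce S) u v →
      TwinDeletion G (S \ {(v : V)})

/-- `G[S]` is obtained from `G` by successively removing true twins until none are left. -/
def IsTwinReduction {V : Type*} (G : SimpleGraph V) (S : Set V) : Prop :=
  TwinDeletion G S ∧ ∀ u v : S, ¬ TrueTwins (G.induce S) u v

/-! ## Co-trees -/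

/-- The two labels of inner nodes of a co-tree. -/
inductive CoLabel
  | union
  | join
  deriving DecidableEq

/-- Rooted trees whose leaves carry vertices and whose inner nodes carry a label and have any
number of subtrees. -/
inductive CoTree (V : Type*)
  | leaf (v : V) : CoTree V
  | node (l : CoLabel) (ts : List (CoTree V)) : CoTree V

namespace CoTree

mutual
/-- The vertices at the leaves of a tree, from left to right. -/
def leaves {V : Type*} : CoTree V → List V
  | leaf v => [v]
  | node _ ts => leavesList ts
/-- The vertices at the leaves of a list of trees, from left to right. -/
def leavesList {V : Type*} : List (CoTree V) → List V
  | [] => []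
  | t :: ts => leaves t ++ leavesList ts
end

mutual
/-- Adjacency in the graph described by a tree. -/
def Adj {V : Type*} : CoTree V → V → V → Prop
  | leaf _, _, _ => False
  | node l ts, u, v => AdjList l ts u v
/-- Adjacency in the union (for `l = union`) or in the join (for `l = join`) of the graphs
described by a list of trees. -/
def AdjList {V : Type*} (l : CoLabel) : List (CoTree V) → V → V → Prop
  | [], _, _ => False
  | t :: ts, u, v => Adj t u v ∨ AdjList l ts u v ∨
      (l = CoLabel.join ∧
        ((u ∈ leaves t ∧ v ∈ leavesList ts) ∨ (v ∈ leaves t ∧ u ∈ leavesList ts)))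
end

/-- The label of the root, if the root is an inner node. -/
def rootLabel {V : Type*} : CoTree V → Option CoLabel
  | leaf _ => none
  | node l _ => some l

/-- Every inner node has at least two subtrees, and the labels alternate on every path from the
root to a leaf. -/
inductive IsCanonical {V : Type*} : CoTree V → Prop
  | leaf (v : V) : IsCanonical (leaf v)
  | node (l : CoLabel) (ts : List (CoTree V)) : 2 ≤ ts.length →
      (∀ t ∈ ts, rootLabel t ≠ some l) → (∀ t ∈ ts, IsCanonical t) → IsCanonical (node l ts)

/-- `T` is a co-tree of `G`: each vertex of `G` is at exactly one leaf, and the edges of `G` are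
those described by `T`. -/
def IsCoTreeOf {V : Type*} (T : CoTree V) (G : SimpleGraph V) : Prop :=
  T.leaves.Nodup ∧ (∀ v, v ∈ T.leaves) ∧ ∀ u v, G.Adj u v ↔ T.Adj u v

/-- `T` is a canonical co-tree of `G`. -/
def IsCanonicalCoTreeOf {V : Type*} (T : CoTree V) (G : SimpleGraph V) : Prop :=
  T.IsCanonical ∧ T.IsCoTreeOf G

end CoTree

/-! ## The algorithm on the canonical co-tree

Each function returns the computed value and the number of executed lines of pseudo-code. -/

/-- The result of a computation, with the number of steps it took. -/
structure Counted where
  value : ℕ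
  steps : ℕ

mutual
/-- The recursive procedure on trees:
`w := root of T; if w is labelled by ∪ then (loop over the subtrees; return m)`
`else if w is labelled by × then (loop over the subtrees; return s + t) else return 1`. -/
def maxTwinlessClique {V : Type*} : CoTree V → Counted
  | CoTree.leaf _ => ⟨1, 4⟩
  | CoTree.node CoLabel.union ts =>
      let r := unionLoop ts 0
      ⟨r.value, r.steps + 4⟩
  | CoTree.node CoLabel.join ts =>
      let r := joinLoop ts 0 0
      ⟨r.value, r.steps + 6⟩
/-- `for all subtrees T' do (k := maxTwinlessClique T'; if k > m then m := k)`; result `m`. -/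
def unionLoop {V : Type*} : List (CoTree V) → ℕ → Counted
  | [], m => ⟨m, 1⟩
  | T' :: ts, m =>
      let k := maxTwinlessClique T'
      let r := unionLoop ts (if k.value > m then k.value else m)
      ⟨r.value, k.steps + r.steps + 4⟩
/-- `for all subtrees T' do (if T' is a leaf then t := 1 else s := s + maxTwinlessClique T')`;
result `s + t`. -/
def joinLoop {V : Type*} : List (CoTree V) → ℕ → ℕ → Counted
  | [], s, t => ⟨s + t, 1⟩
  | CoTree.leaf _ :: ts, s, _ =>
      let r := joinLoop ts s 1
      ⟨r.value, r.steps + 3⟩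
  | CoTree.node l us :: ts, s, t =>
      let k := maxTwinlessClique (CoTree.node l us)
      let r := joinLoop ts (s + k.value) t
      ⟨r.value, k.steps + r.steps + 3⟩
end

/-- The main procedure, for a graph with `n` vertices whose canonical co-tree is `T`:
`return n - maxTwinlessClique T`. -/
def smdFromCoTree {V : Type*} (n : ℕ) (T : CoTree V) : Counted :=
  let r := maxTwinlessClique T
  ⟨n - r.value, r.steps + 2⟩

/-! ## A random access machine with a word size

A program uses finitely many scalar variables and finitely many arrays of words; a word is a
natural number.  Each elementary instruction and each evaluation of a test takes one step. -/

namespace RAM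

/-- Contents of the variables and of the arrays. -/
structure State where
  var : ℕ → ℕ
  arr : ℕ → ℕ → ℕ

/-- Comparisons of two variables. -/
inductive Test
  | lt (x y : ℕ)
  | eq (x y : ℕ)

def Test.Holds (s : State) : Test → Prop
  | lt x y => s.var x < s.var y
  | eq x y => s.var x = s.var y

/-- Programs. -/
inductive Prog
  /-- do nothing -/
  | skip
  /-- `x := k` -/
  | const (x k : ℕ)
  /-- `x := y` -/
  | copy (x y : ℕ)
  /-- `x := y + z` -/
  | add (x y z : ℕ)
  /-- `x := max (y - z) 0` -/
  | sub (x y z : ℕ)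
  /-- `x := a[y]` -/
  | load (x a y : ℕ)
  /-- `a[x] := y` -/
  | store (a x y : ℕ)
  /-- first `p`, then `q` -/
  | seq (p q : Prog)
  /-- if `b` then `p` else `q` -/
  | ite (b : Test) (p q : Prog)
  /-- while `b` do `p` -/
  | while (b : Test) (p : Prog)

/-- Write `k` into the variable `x`. -/
def State.setVar (s : State) (x k : ℕ) : State :=
  { s with var := Function.update s.var x k }

/-- Write `k` into cell `i` of the array `a`. -/
def State.setArr (s : State) (a i k : ℕ) : State :=
  { s with arr := Function.update s.arr a (Function.update (s.arr a) i k) }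

/-- `Runs W p s t s'`: started in state `s`, the program `p` halts after exactly `t` steps in
state `s'`, and no constant or sum that it forms exceeds the largest word `W`
(a computation that would exceed it is stuck). -/
inductive Runs (W : ℕ) : Prog → State → ℕ → State → Prop
  | skip (s : State) : Runs W .skip s 1 s
  | const (s : State) (x k : ℕ) : k ≤ W → Runs W (.const x k) s 1 (s.setVar x k)
  | copy (s : State) (x y : ℕ) : Runs W (.copy x y) s 1 (s.setVar x (s.var y))
  | add (s : State) (x y z : ℕ) : s.var y + s.var z ≤ W →
      Runs W (.add x y z) s 1 (s.setVar x (s.var y + s.var z))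
  | sub (s : State) (x y z : ℕ) : Runs W (.sub x y z) s 1 (s.setVar x (s.var y - s.var z))
  | load (s : State) (x a y : ℕ) : Runs W (.load x a y) s 1 (s.setVar x (s.arr a (s.var y)))
  | store (s : State) (a x y : ℕ) :
      Runs W (.store a x y) s 1 (s.setArr a (s.var x) (s.var y))
  | seq (p q : Prog) (s s' s'' : State) (t t' : ℕ) :
      Runs W p s t s' → Runs W q s' t' s'' → Runs W (.seq p q) s (t + t') s''
  | ite_true (b : Test) (p q : Prog) (s s' : State) (t : ℕ) :
      b.Holds s → Runs W p s t s' → Runs W (.ite b p q) s (t + 1) s'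
  | ite_false (b : Test) (p q : Prog) (s s' : State) (t : ℕ) :
      ¬ b.Holds s → Runs W q s t s' → Runs W (.ite b p q) s (t + 1) s'
  | while_false (b : Test) (p : Prog) (s : State) :
      ¬ b.Holds s → Runs W (.while b p) s 1 s
  | while_true (b : Test) (p : Prog) (s s' s'' : State) (t t' : ℕ) :
      b.Holds s → Runs W p s t s' → Runs W (.while b p) s' t' s'' →
      Runs W (.while b p) s (t + t' + 1) s''

/-- The initial state: the input words are in array `0`, everything else is `0`. -/
def State.initial (input : List ℕ) : State where
  var _ := 0
  arr a i := if a = 0 then input.getD i 0 else 0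

/-- The output is the final value of variable `0`. -/
def State.output (s : State) : ℕ := s.var 0

end RAM

/-- `adj v` lists the neighbours of `v`, each once, in any order. -/
def IsAdjacencyLists {n : ℕ} (G : SimpleGraph (Fin n)) (adj : Fin n → List (Fin n)) : Prop :=
  ∀ v, (adj v).Nodup ∧ ∀ w, w ∈ adj v ↔ G.Adj v w

/-- The input words for a graph given by adjacency lists: `n`, and then for each of the vertices
`0, …, n - 1` its degree followed by its neighbours. -/
def encodeAdjacencyLists {n : ℕ} (adj : Fin n → List (Fin n)) : List ℕ :=
  n :: (List.finRange n).flatMap fun v => (adj v).length :: (adj v).map Fin.val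

/-!
A connected co-graph is a single vertex or a join, so its diameter is at most two. In a graph of
diameter at most two, a vertex different from `u` and `v` can strongly resolve them only if `u` and
`v` are adjacent and have different closed neighbourhoods, and then a vertex in the difference of
the closed neighbourhoods does so. Hence the strong resolving sets are the complements of the
cliques that contain no two true twins, and the strong metric dimension is `n - μ`, where `μ` is the
largest size of such a clique (`strongMetricDim_eq_card_sub`). The set left by successive deletion
of true twins is a transversal of the classes of true twins, and on any transversal the cliques have
the sizes of the cliques of `G` without true twins (`IsTwinTransversal.setOf_card_eq`).

On a canonical co-tree, `μ` is computed from the subtrees because the subgraph at each node is a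
module, so that only its own vertices separate its vertices. In a disjoint union a clique stays in
one part. In a join, vertices of different parts are true twins only if each is universal in its
part; a canonical child with at least two leaves has a `∪` at its root and hence no universal vertex,
so the universal vertices are the children that are leaves, and at most one of them can be used
(`IsTwinlessCliqueNum.join`, `IsTwinlessCliqueNum.insert_universal`).

The program for the random access machine works on the adjacency lists directly, without a co-tree.
It first finds the classes of true twins by splitting the partition of the vertices by each closed
neighbourhood in turn; a part that is split off gets a name that has never been used, so that no
list of the parts has to be maintained, and at most `1 + n + 2m` names are needed (`wp_splitClasses`).
Then it colours one vertex of each class by first fit, in the order of the input (`wp_colorVertex`).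
In a co-graph a first-fit colouring in any order uses exactly as many colours as a largest clique has
vertices (`CographOn.exists_isClique_image_eq`), so the number of colours is `μ`.
-/

/-! ### Cliques without true twins -/

/-- The closed neighbourhood of a vertex. -/
def closedNbhd {V : Type*} (G : SimpleGraph V) (u : V) : Set V := insert u (G.neighborSet u)

/-- Some vertex of `A` lies in exactly one of the closed neighbourhoods of `u` and `v`; for
distinct `u, v ∈ A` this says that `u` and `v` are not true twins in `G[A]`. -/
def Separated {V : Type*} (G : SimpleGraph V) (A : Set V) (u v : V) : Prop :=
  ∃ w ∈ A, ¬ (w ∈ closedNbhd G u ↔ w ∈ closedNbhd G v)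

/-- `K` is a clique of `G[A]` that contains no two true twins of `G[A]`. -/
def IsTwinlessClique {V : Type*} (G : SimpleGraph V) (A : Set V) (K : Finset V) : Prop :=
  (K : Set V) ⊆ A ∧ ∀ u ∈ K, ∀ v ∈ K, u ≠ v → G.Adj u v ∧ Separated G A u v

/-- `k` is the largest size of a clique of `G[A]` without true twins of `G[A]`. -/
def IsTwinlessCliqueNum {V : Type*} (G : SimpleGraph V) (A : Set V) (k : ℕ) : Prop :=
  IsGreatest {k | ∃ K : Finset V, IsTwinlessClique G A K ∧ K.card = k} k

section Graph

variable {V : Type*} {G : SimpleGraph V}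

theorem mem_closedNbhd {u w : V} : w ∈ closedNbhd G u ↔ w = u ∨ G.Adj u w := Iff.rfl

theorem mem_closedNbhd_comm {u w : V} : w ∈ closedNbhd G u ↔ u ∈ closedNbhd G w := by
  simp only [mem_closedNbhd, G.adj_comm, eq_comm]

theorem Separated.symm {A : Set V} {u v : V} (h : Separated G A u v) : Separated G A v u := by
  obtain ⟨w, hw, h⟩ := h
  exact ⟨w, hw, fun h' => h h'.symm⟩

theorem separated_univ_iff {u v : V} :
    Separated G Set.univ u v ↔ closedNbhd G u ≠ closedNbhd G v := by
  simp [Separated, Set.ext_iff]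

/-! ### The strong metric dimension of a graph of diameter two -/

theorem CographOn.nonempty {A : Set V} (h : CographOn G A) : A.Nonempty := by
  induction h with
  | single v => exact ⟨v, rfl⟩
  | union A B _ _ _ _ ihA _ => exact ihA.inl
  | join A B _ _ _ _ ihA _ => exact ihA.inl

theorem not_connected_of_separation {A B : Set V} (hA : A.Nonempty) (hB : B.Nonempty)
    (hd : Disjoint A B) (hcover : A ∪ B = Set.univ) (hAB : ∀ a ∈ A, ∀ b ∈ B, ¬ G.Adj a b) :
    ¬ G.Connected := by
  intro hG
  obtain ⟨a, ha⟩ := hA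
  obtain ⟨b, hb⟩ := hB
  obtain ⟨p⟩ := hG.preconnected a b
  obtain ⟨d, -, h1, h2⟩ := p.exists_boundary_dart A ha (Set.disjoint_right.1 hd hb)
  have : d.snd ∈ A ∪ B := hcover ▸ Set.mem_univ _
  exact hAB _ h1 _ (this.resolve_left h2) d.adj

/-- A connected co-graph with more than one vertex is a join, hence has diameter at most two. -/
theorem IsCograph.exists_common_neighbor (hc : IsCograph G) (hG : G.Connected) {u v : V}
    (huv : u ≠ v) (hadj : ¬ G.Adj u v) : ∃ w, G.Adj u w ∧ G.Adj w v := by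
  unfold IsCograph at hc
  generalize hU : (Set.univ : Set V) = U at hc
  cases hc with
  | single x =>
    have hu : u ∈ ({x} : Set V) := hU ▸ Set.mem_univ u
    have hv : v ∈ ({x} : Set V) := hU ▸ Set.mem_univ v
    exact absurd (hu.trans hv.symm) huv
  | union A B hA hB hd hAB =>
    exact absurd hG (not_connected_of_separation hA.nonempty hB.nonempty hd hU.symm hAB)
  | join A B hA hB hd hAB =>
    have hu : u ∈ A ∪ B := hU ▸ Set.mem_univ u
    have hv : v ∈ A ∪ B := hU ▸ Set.mem_univ v
    obtain ⟨a, ha⟩ := hA.nonempty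
    obtain ⟨b, hb⟩ := hB.nonempty
    rcases hu with hu | hu <;> rcases hv with hv | hv
    · exact ⟨b, hAB u hu b hb, (hAB v hv b hb).symm⟩
    · exact absurd (hAB u hu v hv) hadj
    · exact absurd (hAB v hv u hu).symm hadj
    · exact ⟨a, (hAB a ha u hu).symm, hAB a ha v hv⟩

theorem exists_isPath_length_eq_dist_mem_iff (hG : G.Connected) {w u v : V} :
    (∃ p : G.Walk w u, p.IsPath ∧ p.length = G.dist w u ∧ v ∈ p.support) ↔
      G.dist w u = G.dist w v + G.dist v u := by
  classical
  constructor
  · rintro ⟨p, -, hp, hv⟩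
    have h1 := SimpleGraph.dist_le (p.takeUntil v hv)
    have h2 := SimpleGraph.dist_le (p.dropUntil v hv)
    have h3 : (p.takeUntil v hv).length + (p.dropUntil v hv).length = p.length := by
      rw [← SimpleGraph.Walk.length_append, p.take_spec]
    have h4 := hG.dist_triangle (u := w) (v := v) (w := u)
    omega
  · intro h
    obtain ⟨p, hp⟩ := hG.exists_walk_length_eq_dist w v
    obtain ⟨q, hq⟩ := hG.exists_walk_length_eq_dist v u
    have hl : (p.append q).length = G.dist w u := by
      rw [SimpleGraph.Walk.length_append, hp, hq, h]
    exact ⟨p.append q, SimpleGraph.Walk.isPath_of_length_eq_dist _ hl, hl, by simp⟩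

theorem stronglyResolves_iff (hG : G.Connected) {w u v : V} :
    StronglyResolves G w u v ↔ G.dist w u = G.dist w v + G.dist v u ∨
      G.dist w v = G.dist w u + G.dist u v := by
  rw [StronglyResolves, exists_isPath_length_eq_dist_mem_iff hG,
    exists_isPath_length_eq_dist_mem_iff hG]

/-- In a graph of diameter at most two, a pair of vertices can be strongly resolved by a third
vertex only if it is adjacent and not a pair of true twins, and then the vertex missing from one
of the closed neighbourhoods does resolve it. Hence the complements of the strong resolving sets
are precisely the cliques without true twins. -/
theorem strongMetricDim_eq_card_sub [Fintype V] (hG : G.Connected)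
    (hdiam : ∀ u v, u ≠ v → ¬ G.Adj u v → ∃ w, G.Adj u w ∧ G.Adj w v)
    {k : ℕ} (hk : IsTwinlessCliqueNum G Set.univ k) :
    strongMetricDim G = Fintype.card V - k := by
  classical
  have hdist : ∀ u v, G.dist u v ≤ 2 := by
    intro u v
    by_cases huv : u = v
    · simp [huv]
    by_cases ha : G.Adj u v
    · rw [SimpleGraph.dist_eq_one_iff_adj.2 ha]; norm_num
    · obtain ⟨w, h1, h2⟩ := hdiam u v huv ha
      exact SimpleGraph.dist_le (SimpleGraph.Walk.cons h1 (SimpleGraph.Walk.cons h2 .nil))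
  have hpos : ∀ {u v}, u ≠ v → 0 < G.dist u v := fun h => hG.pos_dist_of_ne h
  have key : ∀ u v w, w ≠ u → w ≠ v → u ≠ v → G.dist w u = G.dist w v + G.dist v u →
      G.Adj u v ∧ Separated G Set.univ u v := by
    intro u v w hwu hwv huv h
    have h1 := hpos hwv
    have h2 := hpos huv.symm
    have h3 := hdist w u
    have hvu : G.Adj v u := SimpleGraph.dist_eq_one_iff_adj.1 (by omega)
    have hvw : G.Adj w v := SimpleGraph.dist_eq_one_iff_adj.1 (by omega)
    refine ⟨hvu.symm, w, trivial, fun hiff => ?_⟩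
    rcases hiff.2 (Or.inr hvw.symm) with h' | h'
    · exact hwu h'
    · have := SimpleGraph.dist_eq_one_iff_adj.2 h'.symm
      omega
  have key2 : ∀ u v w, G.Adj u v → w ∈ closedNbhd G u → w ∉ closedNbhd G v →
      w ≠ v ∧ ¬ G.Adj w v ∧ G.dist w v = G.dist w u + G.dist u v := by
    intro u v w huv hu hv
    rw [mem_closedNbhd] at hu hv
    push Not at hv
    have hwv : ¬ G.Adj w v := fun h => hv.2 h.symm
    rcases hu with rfl | hu
    · exact absurd huv hwv
    · refine ⟨hv.1, hwv, ?_⟩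
      have h1 := SimpleGraph.dist_eq_one_iff_adj.2 huv
      have h2 := SimpleGraph.dist_eq_one_iff_adj.2 hu.symm
      have h3 := hpos hv.1
      have h4 : G.dist w v ≠ 1 := fun h => hwv (SimpleGraph.dist_eq_one_iff_adj.1 h)
      have h5 := hdist w v
      omega
  have hlower : ∀ R : Finset V, IsStrongResolvingSet G R → Fintype.card V - k ≤ R.card := by
    intro R hR
    have hK : IsTwinlessClique G Set.univ Rᶜ := by
      refine ⟨fun _ _ => trivial, fun u hu v hv huv => ?_⟩
      rw [Finset.mem_compl] at hu hv
      obtain ⟨w, hw, hres⟩ := hR u v huv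
      have hwu : w ≠ u := fun h => hu (h ▸ hw)
      have hwv : w ≠ v := fun h => hv (h ▸ hw)
      rcases (stronglyResolves_iff hG).1 hres with h | h
      · exact key u v w hwu hwv huv h
      · have := key v u w hwv hwu huv.symm h
        exact ⟨this.1.symm, this.2.symm⟩
    have h1 := hk.2 ⟨_, hK, rfl⟩
    rw [Finset.card_compl] at h1
    omega
  obtain ⟨⟨K, hK, hKk⟩, -⟩ := hk
  have hres : IsStrongResolvingSet G Kᶜ := by
    intro u v huv
    by_cases hu : u ∈ K
    swap
    · exact ⟨u, Finset.mem_compl.2 hu, (stronglyResolves_iff hG).2 (Or.inr (by simp))⟩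
    by_cases hv : v ∈ K
    swap
    · exact ⟨v, Finset.mem_compl.2 hv, (stronglyResolves_iff hG).2 (Or.inl (by simp))⟩
    obtain ⟨hadj, w, -, hw⟩ := hK.2 u hu v hv huv
    by_cases hwu : w ∈ closedNbhd G u
    · have hwv : w ∉ closedNbhd G v := fun h => hw ⟨fun _ => h, fun _ => hwu⟩
      obtain ⟨hne, hna, hd⟩ := key2 u v w hadj hwu hwv
      exact ⟨w, Finset.mem_compl.2 fun h => hna (hK.2 w h v hv hne).1,
        (stronglyResolves_iff hG).2 (Or.inr hd)⟩
    · have hwv : w ∈ closedNbhd G v := by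
        by_contra h
        exact hw ⟨fun h' => absurd h' hwu, fun h' => absurd h' h⟩
      obtain ⟨hne, hna, hd⟩ := key2 v u w hadj.symm hwv hwu
      exact ⟨w, Finset.mem_compl.2 fun h => hna (hK.2 w h u hu hne).1,
        (stronglyResolves_iff hG).2 (Or.inl hd)⟩
  have hcard : Kᶜ.card = Fintype.card V - k := by rw [Finset.card_compl, hKk]
  refine le_antisymm (Nat.sInf_le ⟨_, hres, hcard⟩) ?_
  obtain ⟨R, hR, hRc⟩ := Nat.sInf_mem
    (s := {k | ∃ R : Finset V, IsStrongResolvingSet G R ∧ R.card = k}) ⟨_, _, hres, hcard⟩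
  unfold strongMetricDim
  rw [← hRc]
  exact hlower R hR

/-! ### Representatives of the classes of true twins -/

/-- `S` contains exactly one vertex of each class of true twins. -/
def IsTwinTransversal {V : Type*} (G : SimpleGraph V) (S : Set V) : Prop :=
  (∀ u, ∃ s ∈ S, closedNbhd G s = closedNbhd G u) ∧
    ∀ s ∈ S, ∀ t ∈ S, closedNbhd G s = closedNbhd G t → s = t

/-- Replacing every vertex by the representative of its class turns a clique without true twins
into a clique of representatives of the same size. -/
theorem IsTwinTransversal.setOf_card_eq {S : Set V} (hS : IsTwinTransversal G S) :
    {k | ∃ K : Finset V, IsTwinlessClique G Set.univ K ∧ K.card = k} =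
      {k | ∃ K : Finset V, (K : Set V) ⊆ S ∧ G.IsClique K ∧ K.card = k} := by
  classical
  ext k
  constructor
  · rintro ⟨K, hK, rfl⟩
    choose r hrS hr using hS.1
    have hinj : Set.InjOn r K := by
      intro u hu v hv h
      by_contra hne
      refine separated_univ_iff.1 (hK.2 u hu v hv hne).2 ?_
      rw [← hr u, ← hr v, h]
    refine ⟨K.image r, ?_, ?_, Finset.card_image_of_injOn hinj⟩
    · intro x hx
      obtain ⟨u, -, rfl⟩ := Finset.mem_image.1 (Finset.mem_coe.1 hx)
      exact hrS u
    · intro x hx y hy hxy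
      obtain ⟨u, hu, rfl⟩ := Finset.mem_image.1 (Finset.mem_coe.1 hx)
      obtain ⟨v, hv, rfl⟩ := Finset.mem_image.1 (Finset.mem_coe.1 hy)
      have huv : u ≠ v := fun h => hxy (h ▸ rfl)
      have h1 : v ∈ closedNbhd G (r u) := by
        rw [hr]; exact Or.inr (hK.2 u hu v hv huv).1
      rw [mem_closedNbhd_comm, ← hr v, mem_closedNbhd_comm] at h1
      exact h1.resolve_left (Ne.symm hxy)
  · rintro ⟨K, hKS, hK, rfl⟩
    refine ⟨K, ⟨fun _ _ => trivial, fun u hu v hv huv => ⟨hK hu hv huv, ?_⟩⟩, rfl⟩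
    exact separated_univ_iff.2 fun h => huv (hS.2 u (hKS hu) v (hKS hv) h)

theorem IsTwinTransversal.cliqueNum_eq {S : Set V} (hS : IsTwinTransversal G S)
    {k : ℕ} (hk : IsTwinlessCliqueNum G Set.univ k) : (G.induce S).cliqueNum = k := by
  classical
  unfold IsTwinlessCliqueNum at hk
  rw [hS.setOf_card_eq] at hk
  rw [← hk.csSup_eq, SimpleGraph.cliqueNum]
  congr 1
  ext j
  constructor
  · rintro ⟨K, hK⟩
    refine ⟨K.map (Function.Embedding.subtype _), ?_, ?_, by simpa using hK.card_eq⟩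
    · intro x hx
      simp only [Finset.coe_map, Set.mem_image] at hx
      obtain ⟨y, -, rfl⟩ := hx
      exact y.2
    · intro x hx y hy hxy
      simp only [Finset.coe_map, Set.mem_image] at hx hy
      obtain ⟨x, hx, rfl⟩ := hx
      obtain ⟨y, hy, rfl⟩ := hy
      exact hK.isClique hx hy fun h => hxy (h ▸ rfl)
  · rintro ⟨K, hKS, hK, rfl⟩
    refine ⟨K.subtype (· ∈ S), ?_, ?_⟩
    · intro x hx y hy hxy
      rw [Finset.mem_coe, Finset.mem_subtype] at hx hy
      exact hK hx hy fun h => hxy (Subtype.ext h)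
    · rw [Finset.card_subtype, Finset.filter_true_of_mem]
      exact fun x hx => hKS hx

/-- Two representatives that are true twins among the representatives are true twins in `G`. -/
theorem closedNbhd_eq_of_trueTwins_induce {S : Set V}
    (hS : ∀ u, ∃ s ∈ S, closedNbhd G s = closedNbhd G u) {u v : S}
    (h : TrueTwins (G.induce S) u v) : closedNbhd G (u : V) = closedNbhd G v := by
  have h' : ∀ w : S, (w : V) ∈ closedNbhd G (u : V) ↔ (w : V) ∈ closedNbhd G (v : V) := by
    intro w
    have := Set.ext_iff.1 h.2 w
    simpa [mem_closedNbhd, Subtype.ext_iff] using this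
  ext w
  obtain ⟨s, hs, hsw⟩ := hS w
  rw [mem_closedNbhd_comm, ← hsw, mem_closedNbhd_comm, h' ⟨s, hs⟩, mem_closedNbhd_comm, hsw,
    mem_closedNbhd_comm]

theorem TwinDeletion.exists_closedNbhd_eq {S : Set V} (h : TwinDeletion G S) :
    ∀ u, ∃ s ∈ S, closedNbhd G s = closedNbhd G u := by
  induction h with
  | start => exact fun u => ⟨u, trivial, rfl⟩
  | delete S u v _ huv ih =>
    intro x
    obtain ⟨s, hs, hsx⟩ := ih x
    by_cases hsv : s = v
    · refine ⟨u, ⟨u.2, fun h => huv.1 (Subtype.ext h)⟩, ?_⟩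
      rw [← hsx, hsv, closedNbhd_eq_of_trueTwins_induce ih huv]
    · exact ⟨s, ⟨hs, hsv⟩, hsx⟩

theorem IsTwinReduction.isTwinTransversal {S : Set V} (h : IsTwinReduction G S) :
    IsTwinTransversal G S := by
  refine ⟨h.1.exists_closedNbhd_eq, fun s hs t ht hst => ?_⟩
  by_contra hne
  refine h.2 ⟨s, hs⟩ ⟨t, ht⟩ ⟨fun h => hne (congrArg Subtype.val h), ?_⟩
  ext w
  have := Set.ext_iff.1 hst w
  simpa [mem_closedNbhd, Subtype.ext_iff] using this

end Graph

/-! ### Twinless cliques in disjoint unions and joins -/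

/-- Some vertex of `A` is adjacent to all other vertices of `A`. -/
def HasUniversal {V : Type*} (G : SimpleGraph V) (A : Set V) : Prop :=
  ∃ u ∈ A, A ⊆ closedNbhd G u

section UnionJoin

variable {V : Type*} {G : SimpleGraph V} {A B : Set V}

theorem IsTwinlessClique.superset {K : Finset V} (hK : IsTwinlessClique G A K) (hAB : A ⊆ B) :
    IsTwinlessClique G B K := by
  refine ⟨hK.1.trans hAB, fun u hu v hv huv => ?_⟩
  obtain ⟨h, w, hw, hs⟩ := hK.2 u hu v hv huv
  exact ⟨h, w, hAB hw, hs⟩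

/-- If `A` is a module of `G[A ∪ B]`, then only vertices of `A` can separate vertices of `A`. -/
theorem IsTwinlessClique.of_module {K K' : Finset V} (hK : IsTwinlessClique G (A ∪ B) K)
    (hK' : K' ⊆ K) (hA : (K' : Set V) ⊆ A)
    (hmod : ∀ w ∈ B, ∀ u ∈ A, ∀ v ∈ A, w ∈ closedNbhd G u → w ∈ closedNbhd G v) :
    IsTwinlessClique G A K' := by
  refine ⟨hA, fun u hu v hv huv => ?_⟩
  obtain ⟨h, w, hw | hw, hs⟩ := hK.2 u (hK' hu) v (hK' hv) huv
  · exact ⟨h, w, hw, hs⟩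
  · exact absurd ⟨hmod w hw u (hA hu) v (hA hv), hmod w hw v (hA hv) u (hA hu)⟩ hs

theorem isTwinlessCliqueNum_empty (G : SimpleGraph V) : IsTwinlessCliqueNum G ∅ 0 := by
  refine ⟨⟨∅, ⟨by simp, by simp⟩, rfl⟩, ?_⟩
  rintro k ⟨K, hK, rfl⟩
  have : K = ∅ := by
    rw [← Finset.coe_eq_empty]; exact Set.subset_empty_iff.1 hK.1
  simp [this]

theorem isTwinlessCliqueNum_singleton (G : SimpleGraph V) (v : V) :
    IsTwinlessCliqueNum G {v} 1 := by
  refine ⟨⟨{v}, ⟨by simp, by simp +contextual⟩, rfl⟩, ?_⟩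
  rintro k ⟨K, hK, rfl⟩
  have : K ⊆ {v} := by
    intro x hx
    simpa using hK.1 hx
  exact Finset.card_le_card this

theorem IsTwinlessCliqueNum.union {a b : ℕ} (hA : IsTwinlessCliqueNum G A a)
    (hB : IsTwinlessCliqueNum G B b) (hd : Disjoint A B)
    (hAB : ∀ u ∈ A, ∀ v ∈ B, ¬ G.Adj u v) : IsTwinlessCliqueNum G (A ∪ B) (max a b) := by
  have hne : ∀ u ∈ A, ∀ v ∈ B, u ≠ v := fun u hu v hv h => Set.disjoint_left.1 hd hu (h ▸ hv)
  have hnotA : ∀ w ∈ B, ∀ u ∈ A, w ∉ closedNbhd G u := by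
    rintro w hw u hu (h | h)
    · exact hne u hu w hw h.symm
    · exact hAB u hu w hw h
  constructor
  · rcases le_total a b with h | h
    · rw [max_eq_right h]
      obtain ⟨K, hK, hc⟩ := hB.1
      exact ⟨K, hK.superset Set.subset_union_right, hc⟩
    · rw [max_eq_left h]
      obtain ⟨K, hK, hc⟩ := hA.1
      exact ⟨K, hK.superset Set.subset_union_left, hc⟩
  · rintro k ⟨K, hK, rfl⟩
    by_cases h : (K : Set V) ⊆ A
    · refine (hA.2 ⟨K, hK.of_module subset_rfl h ?_, rfl⟩).trans (le_max_left _ _)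
      exact fun w hw u hu _ _ h' => absurd h' (hnotA w hw u hu)
    · obtain ⟨v, hvK, hvA⟩ := Set.not_subset.1 h
      have hvB : v ∈ B := (hK.1 hvK).resolve_left hvA
      have hKB : (K : Set V) ⊆ B := by
        intro u hu
        by_contra huB
        have huA : u ∈ A := (hK.1 hu).resolve_right huB
        exact hAB u huA v hvB (hK.2 u hu v hvK (hne u huA v hvB)).1
      rw [Set.union_comm] at hK
      refine (hB.2 ⟨K, hK.of_module subset_rfl hKB ?_, rfl⟩).trans (le_max_right _ _)
      exact fun w hw u hu _ _ h' =>
        absurd (mem_closedNbhd_comm.1 h') (hnotA u hu w hw)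

/-- Without a universal vertex in `A`, every vertex of `A` is separated from every vertex of `B`
in the join, because it misses some vertex of `A`. -/
theorem IsTwinlessCliqueNum.join {a b : ℕ} (hA : IsTwinlessCliqueNum G A a)
    (hB : IsTwinlessCliqueNum G B b) (hd : Disjoint A B)
    (hAB : ∀ u ∈ A, ∀ v ∈ B, G.Adj u v) (hu : ¬ HasUniversal G A) :
    IsTwinlessCliqueNum G (A ∪ B) (a + b) := by
  classical
  constructor
  · obtain ⟨K, hK, rfl⟩ := hA.1
    obtain ⟨L, hL, rfl⟩ := hB.1
    have hsep : ∀ u ∈ K, ∀ v ∈ L, G.Adj u v ∧ Separated G (A ∪ B) u v := by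
      intro u huK v hvL
      have huA := hK.1 huK
      have hvB := hL.1 hvL
      refine ⟨hAB u huA v hvB, ?_⟩
      have : ¬ A ⊆ closedNbhd G u := fun h => hu ⟨u, huA, h⟩
      obtain ⟨w, hwA, hw⟩ := Set.not_subset.1 this
      exact ⟨w, Or.inl hwA, fun h => hw (h.2 (Or.inr (hAB w hwA v hvB).symm))⟩
    refine ⟨K ∪ L, ⟨?_, ?_⟩, Finset.card_union_of_disjoint ?_⟩
    · rw [Finset.coe_union]
      exact Set.union_subset_union hK.1 hL.1
    · intro u hu v hv huv
      rcases Finset.mem_union.1 hu with hu | hu <;> rcases Finset.mem_union.1 hv with hv | hv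
      · exact (hK.superset Set.subset_union_left).2 u hu v hv huv
      · exact hsep u hu v hv
      · exact ⟨(hsep v hv u hu).1.symm, (hsep v hv u hu).2.symm⟩
      · exact (hL.superset Set.subset_union_right).2 u hu v hv huv
    · exact Finset.disjoint_left.2 fun x h1 h2 => Set.disjoint_left.1 hd (hK.1 h1) (hL.1 h2)
  · rintro k ⟨K, hK, rfl⟩
    rw [← Finset.card_filter_add_card_filter_not (s := K) (· ∈ A)]
    refine add_le_add (hA.2 ⟨_, hK.of_module (Finset.filter_subset _ _) ?_ ?_, rfl⟩)
      (hB.2 ⟨_, (Set.union_comm A B ▸ hK).of_module (Finset.filter_subset _ _) ?_ ?_, rfl⟩)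
    · intro x hx
      exact (Finset.mem_filter.1 (Finset.mem_coe.1 hx)).2
    · exact fun w hw u _ v hv _ => Or.inr (hAB v hv w hw)
    · intro x hx
      have := Finset.mem_filter.1 (Finset.mem_coe.1 hx)
      exact (hK.1 this.1).resolve_left this.2
    · exact fun w hw u _ v hv _ => Or.inr (hAB w hw v hv).symm

/-- A further universal vertex `x` is a true twin of the universal vertex already present, by
which it can be replaced in every clique. -/
theorem IsTwinlessCliqueNum.insert_universal {b : ℕ} {x : V} (hB : IsTwinlessCliqueNum G B b)
    (hx : x ∉ B) (hxB : ∀ v ∈ B, G.Adj x v) (hu : HasUniversal G B) :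
    IsTwinlessCliqueNum G ({x} ∪ B) b := by
  classical
  constructor
  · obtain ⟨K, hK, hc⟩ := hB.1
    exact ⟨K, hK.superset Set.subset_union_right, hc⟩
  · rintro k ⟨K, hK, rfl⟩
    have hxu : {x} ∪ B ⊆ closedNbhd G x := by
      rintro w (hw | hw)
      · exact Or.inl hw
      · exact Or.inr (hxB w hw)
    have hmod : ∀ w ∈ ({x} : Set V), ∀ u ∈ B, ∀ v ∈ B,
        w ∈ closedNbhd G u → w ∈ closedNbhd G v := by
      rintro w rfl u _ v hv _
      exact Or.inr (hxB v hv).symm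
    by_cases hxK : x ∈ K
    · obtain ⟨y, hyB, hy⟩ := hu
      have hsub : ((K.erase x : Finset V) : Set V) ⊆ B := by
        intro v hv
        rw [Finset.mem_coe, Finset.mem_erase] at hv
        exact (hK.1 hv.2).resolve_left hv.1
      have hmiss : ∀ v ∈ K.erase x, ¬ B ⊆ closedNbhd G v := by
        intro v hv hBv
        rw [Finset.mem_erase] at hv
        obtain ⟨-, w, hw, hs⟩ := hK.2 v hv.2 x hxK hv.1
        refine hs ⟨fun _ => hxu hw, fun _ => ?_⟩
        rcases hw with rfl | hw
        · exact Or.inr (hK.2 v hv.2 w hxK hv.1).1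
        · exact hBv hw
      have hyK : y ∉ K.erase x := fun h => hmiss y h hy
      have hKe : IsTwinlessClique G B (K.erase x) :=
        (Set.union_comm _ _ ▸ hK).of_module (Finset.erase_subset _ _) hsub hmod
      have hcross : ∀ v ∈ K.erase x, G.Adj y v ∧ Separated G B y v := by
        intro v hv
        obtain ⟨w, hwB, hw⟩ := Set.not_subset.1 (hmiss v hv)
        refine ⟨(hy (hsub hv)).resolve_left fun h => hyK (h ▸ hv), w, hwB, ?_⟩
        exact fun h => hw (h.1 (hy hwB))
      have hnew : IsTwinlessClique G B (insert y (K.erase x)) := by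
        refine ⟨?_, ?_⟩
        · rw [Finset.coe_insert]
          exact Set.insert_subset hyB hsub
        · intro u huK v hvK huv
          rcases Finset.mem_insert.1 huK with rfl | hu <;>
            rcases Finset.mem_insert.1 hvK with rfl | hv
          · exact absurd rfl huv
          · exact hcross v hv
          · exact ⟨(hcross u hu).1.symm, (hcross u hu).2.symm⟩
          · exact hKe.2 u hu v hv huv
      have := hB.2 ⟨_, hnew, rfl⟩
      rwa [Finset.card_insert_of_notMem hyK, Finset.card_erase_add_one hxK] at this
    · have hsub : (K : Set V) ⊆ B := fun v hv =>
        (hK.1 hv).resolve_left fun h => hxK (h ▸ hv)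
      exact hB.2 ⟨K, (Set.union_comm _ _ ▸ hK).of_module subset_rfl hsub hmod, rfl⟩

theorem not_hasUniversal_union (hA : A.Nonempty) (hB : B.Nonempty) (hd : Disjoint A B)
    (hAB : ∀ u ∈ A, ∀ v ∈ B, ¬ G.Adj u v) : ¬ HasUniversal G (A ∪ B) := by
  rintro ⟨u, hu | hu, h⟩
  · obtain ⟨b, hb⟩ := hB
    rcases h (Or.inr hb) with rfl | h'
    · exact Set.disjoint_left.1 hd hu hb
    · exact hAB u hu b hb h'
  · obtain ⟨a, ha⟩ := hA
    rcases h (Or.inl ha) with rfl | h'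
    · exact Set.disjoint_left.1 hd ha hu
    · exact hAB a ha u hu h'.symm

theorem hasUniversal_join (hAB : ∀ u ∈ A, ∀ v ∈ B, G.Adj u v) :
    HasUniversal G (A ∪ B) ↔ HasUniversal G A ∨ HasUniversal G B := by
  constructor
  · rintro ⟨u, hu | hu, h⟩
    · exact Or.inl ⟨u, hu, Set.subset_union_left.trans h⟩
    · exact Or.inr ⟨u, hu, Set.subset_union_right.trans h⟩
  · rintro (⟨u, hu, h⟩ | ⟨u, hu, h⟩)
    · exact ⟨u, Or.inl hu, Set.union_subset h fun v hv => Or.inr (hAB u hu v hv)⟩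
    · exact ⟨u, Or.inr hu, Set.union_subset (fun v hv => Or.inr (hAB v hv u hu).symm) h⟩

end UnionJoin

/-! ### The recursive procedure on canonical co-trees -/

namespace CoTree

variable {V : Type*}

theorem mem_leavesList {ts : List (CoTree V)} {v : V} :
    v ∈ leavesList ts ↔ ∃ t ∈ ts, v ∈ leaves t := by
  induction ts with
  | nil => simp [leavesList]
  | cons t ts ih => simp [leavesList, ih]

theorem leavesList_append (ts us : List (CoTree V)) :
    leavesList (ts ++ us) = leavesList ts ++ leavesList us := by
  induction ts with
  | nil => simp [leavesList]
  | cons t ts ih => simp [leavesList, ih]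

mutual
theorem Adj.mem_leaves : ∀ {t : CoTree V} {u v : V}, t.Adj u v → u ∈ t.leaves ∧ v ∈ t.leaves
  | .leaf _, _, _, h => h.elim
  | .node l ts, u, v, h => by
    rw [leaves]
    exact AdjList.mem_leavesList (l := l) h
theorem AdjList.mem_leavesList : ∀ {l : CoLabel} {ts : List (CoTree V)} {u v : V},
    AdjList l ts u v → u ∈ leavesList ts ∧ v ∈ leavesList ts
  | _, [], _, _, h => h.elim
  | l, t :: ts, u, v, h => by
    simp only [leavesList, List.mem_append]
    rcases h with h | h | ⟨-, h | h⟩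
    · exact ⟨Or.inl (Adj.mem_leaves h).1, Or.inl (Adj.mem_leaves h).2⟩
    · exact ⟨Or.inr (AdjList.mem_leavesList h).1, Or.inr (AdjList.mem_leavesList h).2⟩
    · exact ⟨Or.inl h.1, Or.inr h.2⟩
    · exact ⟨Or.inr h.2, Or.inl h.1⟩
end

theorem adjList_append {l : CoLabel} {ts us : List (CoTree V)} {u v : V} :
    AdjList l (ts ++ us) u v ↔ AdjList l ts u v ∨ AdjList l us u v ∨
      (l = .join ∧ ((u ∈ leavesList ts ∧ v ∈ leavesList us) ∨
        (v ∈ leavesList ts ∧ u ∈ leavesList us))) := by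
  induction ts with
  | nil => simp [AdjList, leavesList]
  | cons t ts ih =>
    simp only [List.cons_append, AdjList, leavesList, ih, leavesList_append, List.mem_append]
    tauto

theorem IsCanonical.leaves_ne_nil {t : CoTree V} (h : t.IsCanonical) : t.leaves ≠ [] := by
  induction h with
  | leaf v => simp [leaves]
  | node l ts hl _ _ ih =>
    match ts, hl with
    | t :: ts, _ =>
      simp [leaves, leavesList, ih t]

/-- The subtrees `ts` describe, under the label `l`, the subgraph of `G` induced by their leaves;
each vertex of it is at exactly one leaf. -/
def DescribesList (G : SimpleGraph V) (l : CoLabel) (ts : List (CoTree V)) : Prop :=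
  (leavesList ts).Nodup ∧
    ∀ u ∈ leavesList ts, ∀ v ∈ leavesList ts, G.Adj u v ↔ AdjList l ts u v

/-- The tree `t` describes the subgraph of `G` induced by its leaves; each vertex of it is at
exactly one leaf. -/
def Describes (G : SimpleGraph V) (t : CoTree V) : Prop :=
  t.leaves.Nodup ∧ ∀ u ∈ t.leaves, ∀ v ∈ t.leaves, G.Adj u v ↔ t.Adj u v

section

variable {G : SimpleGraph V} {l : CoLabel} {t : CoTree V} {ts : List (CoTree V)}

theorem DescribesList.disjoint (h : DescribesList G l (t :: ts)) :
    Disjoint {v | v ∈ t.leaves} {v | v ∈ leavesList ts} := by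
  have := h.1
  rw [leavesList, List.nodup_append] at this
  exact Set.disjoint_left.2 fun x h1 h2 => this.2.2 x h1 x h2 rfl

theorem DescribesList.adj_iff (h : DescribesList G l (t :: ts)) :
    ∀ u ∈ {v | v ∈ t.leaves}, ∀ v ∈ {v | v ∈ leavesList ts}, G.Adj u v ↔ l = .join := by
  intro u hu v hv
  have hd := h.disjoint
  rw [h.2 u (by simp [leavesList, show u ∈ t.leaves from hu]) v
    (by simp [leavesList, show v ∈ leavesList ts from hv]), AdjList]
  have h1 : ¬ t.Adj u v := fun h' => Set.disjoint_left.1 hd h'.mem_leaves.2 hv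
  have h2 : ¬ AdjList l ts u v := fun h' => Set.disjoint_left.1 hd hu h'.mem_leavesList.1
  have hu' : u ∈ t.leaves := hu
  have hv' : v ∈ leavesList ts := hv
  simp [h1, h2, hu', hv']

theorem DescribesList.head (h : DescribesList G l (t :: ts)) : Describes G t := by
  have hn := h.1
  rw [leavesList, List.nodup_append] at hn
  refine ⟨hn.1, fun u hu v hv => ?_⟩
  have hd := h.disjoint
  have hu' : u ∉ leavesList ts := fun h' => Set.disjoint_left.1 hd hu h'
  have hv' : v ∉ leavesList ts := fun h' => Set.disjoint_left.1 hd hv h'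
  have h2 : ¬ AdjList l ts u v := fun h' => hu' h'.mem_leavesList.1
  rw [h.2 u (by simp [leavesList, hu]) v (by simp [leavesList, hv]), AdjList]
  simp [h2, hu', hv']

theorem DescribesList.tail (h : DescribesList G l (t :: ts)) : DescribesList G l ts := by
  have hn := h.1
  rw [leavesList, List.nodup_append] at hn
  refine ⟨hn.2.1, fun u hu v hv => ?_⟩
  have hd := h.disjoint
  have hu' : u ∉ t.leaves := fun h' => Set.disjoint_left.1 hd h' hu
  have hv' : v ∉ t.leaves := fun h' => Set.disjoint_left.1 hd h' hv
  have h2 : ¬ t.Adj u v := fun h' => hu' h'.mem_leaves.1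
  rw [h.2 u (by simp [leavesList, hu]) v (by simp [leavesList, hv]), AdjList]
  simp [h2, hu', hv']

theorem setOf_mem_leavesList_cons (t : CoTree V) (ts : List (CoTree V)) :
    {v | v ∈ leavesList (t :: ts)} = {v | v ∈ t.leaves} ∪ {v | v ∈ leavesList ts} := by
  ext v; simp [leavesList]

theorem exists_unionLoop_value_eq (hts : ∀ t ∈ ts, Describes G t →
      IsTwinlessCliqueNum G {v | v ∈ t.leaves} (maxTwinlessClique t).value)
    (h : DescribesList G .union ts) :
    ∃ k, IsTwinlessCliqueNum G {v | v ∈ leavesList ts} k ∧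
      ∀ m, (unionLoop ts m).value = max m k := by
  induction ts with
  | nil =>
    refine ⟨0, ?_, by simp [unionLoop]⟩
    simpa [leavesList] using isTwinlessCliqueNum_empty G
  | cons t ts ih =>
    obtain ⟨k, hk, hval⟩ := ih (fun t ht => hts t (List.mem_cons_of_mem _ ht)) h.tail
    refine ⟨max (maxTwinlessClique t).value k, ?_, fun m => ?_⟩
    · rw [setOf_mem_leavesList_cons]
      refine (hts t List.mem_cons_self h.head).union hk h.disjoint fun u hu v hv => ?_
      rw [h.adj_iff u hu v hv]
      simp
    · simp only [unionLoop, hval]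
      split_ifs <;> omega

/-- In a join, the universal vertices are the leaves among the children, and exactly one of them
can be used by a clique without true twins. -/
theorem exists_joinLoop_value_eq (hts : ∀ t ∈ ts, Describes G t →
      IsTwinlessCliqueNum G {v | v ∈ t.leaves} (maxTwinlessClique t).value ∧
        (t.rootLabel = some .union → ¬ HasUniversal G {v | v ∈ t.leaves}))
    (hroot : ∀ t ∈ ts, t.rootLabel ≠ some .join) (h : DescribesList G .join ts) :
    ∃ s e, IsTwinlessCliqueNum G {v | v ∈ leavesList ts} (s + e) ∧
      ((e = 0 ∧ ¬ HasUniversal G {v | v ∈ leavesList ts} ∧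
          ∀ s' t', (joinLoop ts s' t').value = s' + s + t') ∨
        (e = 1 ∧ HasUniversal G {v | v ∈ leavesList ts} ∧
          ∀ s' t', (joinLoop ts s' t').value = s' + s + 1)) := by
  induction ts with
  | nil =>
    refine ⟨0, 0, ?_, Or.inl ⟨rfl, ?_, by simp [joinLoop]⟩⟩
    · simpa [leavesList] using isTwinlessCliqueNum_empty G
    · rintro ⟨u, hu, -⟩
      simp [leavesList] at hu
  | cons t ts ih =>
    obtain ⟨s, e, hk, hval⟩ := ih (fun t ht => hts t (List.mem_cons_of_mem _ ht))
      (fun t ht => hroot t (List.mem_cons_of_mem _ ht)) h.tail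
    have hadj : ∀ u ∈ {v | v ∈ t.leaves}, ∀ v ∈ {v | v ∈ leavesList ts}, G.Adj u v :=
      fun u hu v hv => (h.adj_iff u hu v hv).2 rfl
    have hd := h.disjoint
    rw [setOf_mem_leavesList_cons, hasUniversal_join hadj]
    match t, hts, hroot, h with
    | .leaf x, hts, hroot, h =>
      have hx : {v | v ∈ (leaf x).leaves} = {x} := by ext v; simp [leaves]
      have hux : HasUniversal G {v | v ∈ (leaf x).leaves} := by
        rw [hx]
        exact ⟨x, rfl, fun v hv => Or.inl hv⟩
      refine ⟨s, 1, ?_, Or.inr ⟨rfl, Or.inl hux, ?_⟩⟩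
      · rw [hx] at hd hadj ⊢
        rcases hval with ⟨rfl, hu, -⟩ | ⟨rfl, hu, -⟩
        · rw [Set.union_comm]
          exact hk.join (isTwinlessCliqueNum_singleton G x) hd.symm
            (fun u hu v hv => (hadj v hv u hu).symm) hu
        · exact hk.insert_universal (fun hxt => Set.disjoint_left.1 hd rfl hxt)
            (hadj x rfl) hu
      · intro s' t'
        simp only [joinLoop]
        rcases hval with ⟨-, -, hv⟩ | ⟨-, -, hv⟩ <;> rw [hv]
    | .node .join us, hts, hroot, h => exact absurd rfl (hroot _ List.mem_cons_self)
    | .node .union us, hts, hroot, h =>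
      obtain ⟨hv, hu⟩ := hts _ List.mem_cons_self h.head
      replace hu := hu rfl
      refine ⟨(maxTwinlessClique (.node .union us)).value + s, e, ?_, ?_⟩
      · rw [add_assoc]
        exact hv.join hk hd hadj hu
      · simp only [hu, false_or, joinLoop]
        refine hval.imp (fun h => ⟨h.1, h.2.1, fun s' t' => ?_⟩)
          (fun h => ⟨h.1, h.2.1, fun s' t' => ?_⟩) <;> rw [h.2.2] <;> omega

theorem IsCanonical.isTwinlessCliqueNum (hc : t.IsCanonical) (h : Describes G t) :
    IsTwinlessCliqueNum G {v | v ∈ t.leaves} (maxTwinlessClique t).value ∧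
      (t.rootLabel = some .union → ¬ HasUniversal G {v | v ∈ t.leaves}) := by
  induction hc with
  | leaf v =>
    refine ⟨?_, by simp [rootLabel]⟩
    simpa [leaves, maxTwinlessClique] using isTwinlessCliqueNum_singleton G v
  | node l ts hlen hroot hcan ih =>
    cases l with
    | union =>
      have h' : DescribesList G .union ts := h
      constructor
      · obtain ⟨k, hk, hval⟩ := exists_unionLoop_value_eq (fun t ht h => (ih t ht h).1) h'
        simpa [maxTwinlessClique, hval, leaves] using hk
      · intro _
        match ts, hlen, h', hcan with
        | t :: t' :: ts, _, h', hcan =>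
          have hne : ∀ t : CoTree V, t.IsCanonical → ∃ v, v ∈ t.leaves :=
            fun t ht => List.exists_mem_of_ne_nil _ ht.leaves_ne_nil
          obtain ⟨a, ha⟩ := hne t (hcan t (by simp))
          obtain ⟨b, hb⟩ := hne t' (hcan t' (by simp))
          change ¬ HasUniversal G {v | v ∈ leavesList (t :: t' :: ts)}
          rw [setOf_mem_leavesList_cons]
          refine not_hasUniversal_union ⟨a, ha⟩ ⟨b, ?_⟩ h'.disjoint fun u hu v hv => ?_
          · simp [leavesList, hb]
          · rw [h'.adj_iff u hu v hv]
            simp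
    | join =>
      have h' : DescribesList G .join ts := h
      refine ⟨?_, by simp [rootLabel]⟩
      obtain ⟨s, e, hk, hval⟩ := exists_joinLoop_value_eq ih hroot h'
      have : (maxTwinlessClique (CoTree.node .join ts)).value = s + e := by
        rw [maxTwinlessClique]
        rcases hval with ⟨rfl, -, hv⟩ | ⟨rfl, -, hv⟩ <;> simp [hv]
      rw [this]
      exact hk

theorem IsCanonicalCoTreeOf.isTwinlessCliqueNum (h : t.IsCanonicalCoTreeOf G) :
    IsTwinlessCliqueNum G Set.univ (maxTwinlessClique t).value := by
  have huniv : {v | v ∈ t.leaves} = Set.univ := Set.eq_univ_of_forall h.2.2.1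
  rw [← huniv]
  exact (h.1.isTwinlessCliqueNum ⟨h.2.1, fun u _ v _ => h.2.2.2 u v⟩).1

/-! ### The number of steps of the recursive procedure -/

theorem unionLoop_steps_le (hts : ∀ t ∈ ts, (maxTwinlessClique t).steps + 15 ≤ 19 * t.leaves.length)
    (m : ℕ) : (unionLoop ts m).steps + 11 * ts.length ≤ 19 * (leavesList ts).length + 1 := by
  induction ts generalizing m with
  | nil => simp [unionLoop]
  | cons t ts ih =>
    have h1 := hts t List.mem_cons_self
    have h2 := ih (fun t ht => hts t (List.mem_cons_of_mem _ ht))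
      (if (maxTwinlessClique t).value > m then (maxTwinlessClique t).value else m)
    simp only [unionLoop, leavesList, List.length_append, List.length_cons]
    omega

theorem joinLoop_steps_le (hts : ∀ t ∈ ts, (maxTwinlessClique t).steps + 15 ≤ 19 * t.leaves.length)
    (s e : ℕ) : (joinLoop ts s e).steps + 11 * ts.length ≤ 19 * (leavesList ts).length + 1 := by
  induction ts generalizing s e with
  | nil => simp [joinLoop]
  | cons t ts ih =>
    have h1 := hts t List.mem_cons_self
    have h2 := ih (fun t ht => hts t (List.mem_cons_of_mem _ ht))
    match t, h1 with
    | .leaf v, _ =>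
      have h3 := h2 s 1
      simp only [joinLoop, leavesList, leaves, List.length_append, List.length_cons,
        List.length_nil]
      omega
    | .node l us, h1 =>
      have h3 := h2 (s + (maxTwinlessClique (.node l us)).value) e
      simp only [joinLoop, leavesList, List.length_append, List.length_cons]
      omega

/-- The slack `15` pays for the constant work at an inner node, which has two children or more:
each child contributes its own slack, less the cost of one iteration. -/
theorem IsCanonical.steps_le (hc : t.IsCanonical) :
    (maxTwinlessClique t).steps + 15 ≤ 19 * t.leaves.length := by
  induction hc with
  | leaf v => simp [maxTwinlessClique, leaves]
  | node l ts hlen _ _ ih =>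
    cases l with
    | union =>
      have := unionLoop_steps_le ih 0
      simp only [maxTwinlessClique, leaves]
      omega
    | join =>
      have := joinLoop_steps_le ih 0 0
      simp only [maxTwinlessClique, leaves]
      omega

theorem IsCanonicalCoTreeOf.smdFromCoTree_steps_le [Fintype V] (h : t.IsCanonicalCoTreeOf G) :
    (smdFromCoTree (Fintype.card V) t).steps ≤ 19 * Fintype.card V := by
  classical
  have h1 := h.1.steps_le
  have h2 : t.leaves.length = Fintype.card V := by
    rw [← List.toFinset_card_of_nodup h.2.1, ← Finset.card_univ]
    congr 1
    ext v
    simp [h.2.2.1 v]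
  simp only [smdFromCoTree]
  omega

/-! ### Existence of canonical co-trees -/

/-- The subtrees that `t` contributes to a root labelled `l`: its own subtrees if its root is
labelled `l` as well, and `t` itself otherwise. -/
def childrenFor (l : CoLabel) : CoTree V → List (CoTree V)
  | leaf v => [leaf v]
  | node l' ts => if l' = l then ts else [node l' ts]

theorem leavesList_childrenFor (l : CoLabel) (t : CoTree V) :
    leavesList (childrenFor l t) = t.leaves := by
  cases t with
  | leaf v => simp [childrenFor, leavesList]
  | node l' ts => rw [childrenFor]; split_ifs <;> simp [leavesList, leaves]

theorem adjList_childrenFor (l : CoLabel) (t : CoTree V) (u v : V) :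
    AdjList l (childrenFor l t) u v ↔ t.Adj u v := by
  cases t with
  | leaf v => simp [childrenFor, AdjList, leavesList]
  | node l' ts =>
    rw [childrenFor]
    split_ifs with h
    · subst h; rfl
    · simp [AdjList, leavesList]

theorem IsCanonical.childrenFor_spec (hc : t.IsCanonical) (l : CoLabel) :
    1 ≤ (childrenFor l t).length ∧
      ∀ c ∈ childrenFor l t, c.rootLabel ≠ some l ∧ c.IsCanonical := by
  cases hc with
  | leaf v => simp [childrenFor, rootLabel, IsCanonical.leaf]
  | node l' ts hlen hroot hcan =>
    rw [childrenFor]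
    split_ifs with h
    · subst h
      exact ⟨by omega, fun c hc => ⟨hroot c hc, hcan c hc⟩⟩
    · refine ⟨by simp, fun c hc => ?_⟩
      rw [List.mem_singleton] at hc
      subst hc
      exact ⟨by simpa [rootLabel] using h, .node l' ts hlen hroot hcan⟩

theorem exists_isCanonical_combine {A B : Set V} (l : CoLabel) (hd : Disjoint A B)
    (hAB : ∀ a ∈ A, ∀ b ∈ B, G.Adj a b ↔ l = .join)
    (hA : ∃ t : CoTree V, t.IsCanonical ∧ Describes G t ∧ ∀ v, v ∈ t.leaves ↔ v ∈ A)
    (hB : ∃ t : CoTree V, t.IsCanonical ∧ Describes G t ∧ ∀ v, v ∈ t.leaves ↔ v ∈ B) :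
    ∃ t : CoTree V, t.IsCanonical ∧ Describes G t ∧ ∀ v, v ∈ t.leaves ↔ v ∈ A ∪ B := by
  obtain ⟨t, htc, htd, ht⟩ := hA
  obtain ⟨t', htc', htd', ht'⟩ := hB
  obtain ⟨h1, h2⟩ := htc.childrenFor_spec l
  obtain ⟨h1', h2'⟩ := htc'.childrenFor_spec l
  have hleaves : (node l (childrenFor l t ++ childrenFor l t')).leaves =
      t.leaves ++ t'.leaves := by
    rw [leaves, leavesList_append, leavesList_childrenFor, leavesList_childrenFor]
  have hmem : ∀ c ∈ childrenFor l t ++ childrenFor l t', c.rootLabel ≠ some l ∧ c.IsCanonical :=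
    fun c hc => (List.mem_append.1 hc).elim (h2 c) (h2' c)
  refine ⟨node l (childrenFor l t ++ childrenFor l t'), .node _ _ ?_ (fun c hc => (hmem c hc).1)
    (fun c hc => (hmem c hc).2), ⟨?_, ?_⟩, ?_⟩
  · rw [List.length_append]; omega
  · rw [hleaves, List.nodup_append]
    refine ⟨htd.1, htd'.1, fun a ha b hb hab => ?_⟩
    exact Set.disjoint_left.1 hd ((ht a).1 ha) ((ht' a).1 (hab ▸ hb))
  · rw [hleaves]
    intro u hu v hv
    rw [Adj, adjList_append, adjList_childrenFor, adjList_childrenFor, leavesList_childrenFor,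
      leavesList_childrenFor]
    have hdis : ∀ x, x ∈ t.leaves → x ∈ t'.leaves → False := fun x h h' =>
      Set.disjoint_left.1 hd ((ht x).1 h) ((ht' x).1 h')
    have hn : ∀ x y, x ∈ t.leaves → ¬ t'.Adj x y ∧ ¬ t'.Adj y x := fun x y h =>
      ⟨fun h' => hdis x h h'.mem_leaves.1, fun h' => hdis x h h'.mem_leaves.2⟩
    have hn' : ∀ x y, x ∈ t'.leaves → ¬ t.Adj x y ∧ ¬ t.Adj y x := fun x y h =>
      ⟨fun h' => hdis x h'.mem_leaves.1 h, fun h' => hdis x h'.mem_leaves.2 h⟩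
    have hcross : ∀ x y, x ∈ t.leaves → y ∈ t'.leaves → (G.Adj x y ↔ l = .join) :=
      fun x y h h' => hAB x ((ht x).1 h) y ((ht' y).1 h')
    rcases List.mem_append.1 hu with hu | hu <;> rcases List.mem_append.1 hv with hv | hv
    · have := hdis u hu
      have := hdis v hv
      have := (hn u v hu).1
      rw [htd.2 u hu v hv]
      tauto
    · have := (hn u v hu).1
      have := (hn' v u hv).2
      rw [hcross u v hu hv]
      tauto
    · have := (hn v u hv).2
      have := (hn' u v hu).1
      rw [G.adj_comm, hcross v u hv hu]
      tauto
    · have := fun h => hdis u h hu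
      have := fun h => hdis v h hv
      have := (hn' u v hu).1
      rw [htd'.2 u hu v hv]
      tauto
  · intro v
    rw [hleaves, List.mem_append, ht, ht', Set.mem_union]

theorem _root_.CographOn.exists_isCanonical {A : Set V} (h : CographOn G A) :
    ∃ t : CoTree V, t.IsCanonical ∧ Describes G t ∧ ∀ v, v ∈ t.leaves ↔ v ∈ A := by
  induction h with
  | single v =>
    refine ⟨leaf v, .leaf v, ⟨by simp [leaves], ?_⟩, by simp [leaves]⟩
    simp [leaves, Adj]
  | union A B _ _ hd hAB ihA ihB =>
    exact exists_isCanonical_combine .union hd (fun a ha b hb => by simp [hAB a ha b hb]) ihA ihB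
  | join A B _ _ hd hAB ihA ihB =>
    exact exists_isCanonical_combine .join hd (fun a ha b hb => by simp [hAB a ha b hb]) ihA ihB

theorem _root_.IsCograph.exists_isCanonicalCoTreeOf (h : IsCograph G) :
    ∃ t : CoTree V, t.IsCanonicalCoTreeOf G := by
  obtain ⟨t, hc, hd, hv⟩ := CographOn.exists_isCanonical h
  have hall : ∀ v, v ∈ t.leaves := fun v => (hv v).2 trivial
  exact ⟨t, hc, hd.1, hall, fun u v => hd.2 u (hall u) v (hall v)⟩

end

end CoTree

/-! ### First-fit colourings of co-graphs -/

section FirstFit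

variable {V : Type*} {G : SimpleGraph V}

/-- Let `c` be a colouring of `S` in which every vertex has a neighbour of each smaller colour that
occurs. In a co-graph there is then a clique in which each colour occurs: in a disjoint union all
colours occur on the side of the largest one, and in a join no colour occurs on both sides. The
condition on `c` refers only to colours that occur, because this is what the sides of a join
inherit. -/
theorem CographOn.exists_isClique_image_eq [Finite V] {A : Set V} (hA : CographOn G A) (S : Set V)
    (c : V → ℕ)
    (hproper : ∀ u ∈ A ∩ S, ∀ v ∈ A ∩ S, G.Adj u v → c u ≠ c v)
    (hfit : ∀ u ∈ A ∩ S, ∀ x ∈ A ∩ S, c x < c u → ∃ w ∈ A ∩ S, G.Adj u w ∧ c w = c x) :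
    ∃ K : Finset V, (K : Set V) ⊆ A ∩ S ∧ G.IsClique K ∧ c '' K = c '' (A ∩ S) := by
  classical
  induction hA with
  | single v =>
    by_cases hv : v ∈ S
    · refine ⟨{v}, by simpa using hv, by simp, ?_⟩
      have : ({v} : Set V) ∩ S = {v} := by simpa using hv
      rw [this, Finset.coe_singleton]
    · refine ⟨∅, by simp, by simp, ?_⟩
      have : ({v} : Set V) ∩ S = ∅ := by simpa using hv
      rw [this, Finset.coe_empty]
  | union A B _ _ hd hAB ihA ihB =>
    have hmono : ∀ {X}, X ⊆ A ∪ B → X ∩ S ⊆ (A ∪ B) ∩ S := fun h =>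
      Set.inter_subset_inter_left S h
    have hl := hmono (X := A) Set.subset_union_left
    have hr := hmono (X := B) Set.subset_union_right
    obtain ⟨K, hK, hKc, hKi⟩ := ihA
      (fun u hu v hv => hproper u (hl hu) v (hl hv)) (fun u hu x hx hlt => by
        obtain ⟨w, hw, hadj, hcw⟩ := hfit u (hl hu) x (hl hx) hlt
        exact ⟨w, ⟨hw.1.resolve_right fun h => hAB u hu.1 w h hadj, hw.2⟩, hadj, hcw⟩)
    obtain ⟨L, hL, hLc, hLi⟩ := ihB
      (fun u hu v hv => hproper u (hr hu) v (hr hv)) (fun u hu x hx hlt => by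
        obtain ⟨w, hw, hadj, hcw⟩ := hfit u (hr hu) x (hr hx) hlt
        exact ⟨w, ⟨hw.1.resolve_left fun h => hAB w h u hu.1 hadj.symm, hw.2⟩, hadj, hcw⟩)
    by_cases hemp : ((A ∪ B) ∩ S).Nonempty
    swap
    · rw [Set.not_nonempty_iff_eq_empty] at hemp
      refine ⟨∅, by simp, by simp, by rw [hemp]; simp⟩
    obtain ⟨z, hz, hmax⟩ := Set.exists_max_image _ c (Set.toFinite _) hemp
    rcases hz with ⟨hz | hz, hzS⟩
    · refine ⟨K, hK.trans hl, hKc, hKi.trans (Set.Subset.antisymm (Set.image_mono hl) ?_)⟩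
      rintro _ ⟨x, hx, rfl⟩
      rcases (hmax x hx).lt_or_eq with h | h
      · obtain ⟨w, hw, hadj, hcw⟩ := hfit z ⟨Or.inl hz, hzS⟩ x hx h
        exact ⟨w, ⟨hw.1.resolve_right fun h => hAB z hz w h hadj, hw.2⟩, hcw⟩
      · exact ⟨z, ⟨hz, hzS⟩, h.symm⟩
    · refine ⟨L, hL.trans hr, hLc, hLi.trans (Set.Subset.antisymm (Set.image_mono hr) ?_)⟩
      rintro _ ⟨x, hx, rfl⟩
      rcases (hmax x hx).lt_or_eq with h | h
      · obtain ⟨w, hw, hadj, hcw⟩ := hfit z ⟨Or.inr hz, hzS⟩ x hx h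
        exact ⟨w, ⟨hw.1.resolve_left fun h => hAB w h z hz hadj.symm, hw.2⟩, hcw⟩
      · exact ⟨z, ⟨hz, hzS⟩, h.symm⟩
  | join A B _ _ hd hAB ihA ihB =>
    have hl : A ∩ S ⊆ (A ∪ B) ∩ S := Set.inter_subset_inter_left S Set.subset_union_left
    have hr : B ∩ S ⊆ (A ∪ B) ∩ S := Set.inter_subset_inter_left S Set.subset_union_right
    have hcne : ∀ a ∈ A ∩ S, ∀ b ∈ B ∩ S, c a ≠ c b := fun a ha b hb =>
      hproper a (hl ha) b (hr hb) (hAB a ha.1 b hb.1)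
    obtain ⟨K, hK, hKc, hKi⟩ := ihA
      (fun u hu v hv => hproper u (hl hu) v (hl hv)) (fun u hu x hx hlt => by
        obtain ⟨w, hw, hadj, hcw⟩ := hfit u (hl hu) x (hl hx) hlt
        exact ⟨w, ⟨hw.1.resolve_right fun h => hcne x hx w ⟨h, hw.2⟩ hcw.symm, hw.2⟩, hadj, hcw⟩)
    obtain ⟨L, hL, hLc, hLi⟩ := ihB
      (fun u hu v hv => hproper u (hr hu) v (hr hv)) (fun u hu x hx hlt => by
        obtain ⟨w, hw, hadj, hcw⟩ := hfit u (hr hu) x (hr hx) hlt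
        exact ⟨w, ⟨hw.1.resolve_left fun h => hcne w ⟨h, hw.2⟩ x hx hcw, hw.2⟩, hadj, hcw⟩)
    refine ⟨K ∪ L, ?_, ?_, ?_⟩
    · rw [Finset.coe_union]
      exact Set.union_subset (hK.trans hl) (hL.trans hr)
    · rw [Finset.coe_union]
      intro u hu v hv huv
      rcases hu with hu | hu <;> rcases hv with hv | hv
      · exact hKc hu hv huv
      · exact hAB u (hK hu).1 v (hL hv).1
      · exact (hAB v (hK hv).1 u (hL hu).1).symm
      · exact hLc hu hv huv
    · rw [Finset.coe_union, Set.image_union, hKi, hLi, ← Set.image_union,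
        Set.union_inter_distrib_right]

/-- `c` is a first-fit colouring of the vertices with a nonzero colour, and `k` is its largest
colour; the colour `0` stands for uncoloured vertices. -/
structure IsFirstFit {V : Type*} (G : SimpleGraph V) (c : V → ℕ) (k : ℕ) : Prop where
  proper : ∀ u v, G.Adj u v → c u ≠ 0 → c u ≠ c v
  fit : ∀ u, ∀ j, j ≠ 0 → j < c u → ∃ w, G.Adj u w ∧ c w = j
  le : ∀ u, c u ≤ k
  attained : k = 0 ∨ ∃ u, c u = k

/-- A first-fit colouring of a transversal of the classes of true twins uses as many colours as a
largest clique without true twins has vertices. -/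
theorem IsFirstFit.isTwinlessCliqueNum [Finite V] {c : V → ℕ} {k : ℕ} (h : IsFirstFit G c k)
    (hG : IsCograph G) (hS : IsTwinTransversal G {v | c v ≠ 0}) :
    IsTwinlessCliqueNum G Set.univ k := by
  classical
  obtain ⟨K, hKS, hK, hKi⟩ := CographOn.exists_isClique_image_eq hG {v | c v ≠ 0} c
    (fun u hu v _ huv => h.proper u v huv hu.2) (fun u _ x hx hlt => by
      obtain ⟨w, hw, hcw⟩ := h.fit u (c x) hx.2 hlt
      exact ⟨w, ⟨trivial, fun h0 => hx.2 (hcw ▸ h0)⟩, hw, hcw⟩)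
  rw [Set.univ_inter] at hKS hKi
  have hinj : ∀ L : Finset V, (L : Set V) ⊆ {v | c v ≠ 0} → G.IsClique L → Set.InjOn c L := by
    intro L hLS hL u hu v hv huv
    by_contra hne
    exact h.proper u v (hL hu hv hne) (hLS hu) huv
  have himage : K.image c = Finset.Icc 1 k := by
    rw [← Finset.coe_inj, Finset.coe_image, hKi]
    ext j
    simp only [Set.mem_image, Set.mem_ofPred_eq, Finset.coe_Icc, Set.mem_Icc]
    constructor
    · rintro ⟨u, hu, rfl⟩
      exact ⟨Nat.one_le_iff_ne_zero.2 hu, h.le u⟩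
    · rintro ⟨h1, h2⟩
      rcases h.attained with h0 | ⟨u, hu⟩
      · omega
      · rcases h2.lt_or_eq with h2 | h2
        · obtain ⟨w, -, hw⟩ := h.fit u j (by omega) (by omega)
          exact ⟨w, by omega, hw⟩
        · exact ⟨u, by omega, by omega⟩
  unfold IsTwinlessCliqueNum
  rw [hS.setOf_card_eq]
  refine ⟨⟨K, hKS, hK, ?_⟩, ?_⟩
  · rw [← Finset.card_image_of_injOn (hinj K hKS hK), himage, Nat.card_Icc]
    omega
  · rintro _ ⟨L, hLS, hL, rfl⟩
    have hsub : L.image c ⊆ Finset.Icc 1 k := by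
      intro j hj
      obtain ⟨u, hu, rfl⟩ := Finset.mem_image.1 hj
      exact Finset.mem_Icc.2 ⟨Nat.one_le_iff_ne_zero.2 (hLS hu), h.le u⟩
    have := Finset.card_le_card hsub
    rwa [Finset.card_image_of_injOn (hinj L hLS hL), Nat.card_Icc, Nat.add_sub_cancel] at this

end FirstFit

/-! ### Reasoning about programs -/

namespace RAM

/-- Total correctness with running time: started in `s`, the program `p` halts after some number
`t` of steps in some state `s'`, without exceeding the word size, and `Q t s'` holds. -/
def Wp (W : ℕ) (p : Prog) (s : State) (Q : ℕ → State → Prop) : Prop :=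
  ∃ t s', Runs W p s t s' ∧ Q t s'

/-- Sequential composition of a list of programs. -/
def block : List Prog → Prog
  | [] => .skip
  | p :: ps => .seq p (block ps)

section Wp

variable {W : ℕ} {p q : Prog} {s : State} {Q R : ℕ → State → Prop}

theorem Wp.mono (h : Wp W p s Q) (hQ : ∀ t s', Q t s' → R t s') : Wp W p s R := by
  obtain ⟨t, s', hr, h⟩ := h
  exact ⟨t, s', hr, hQ t s' h⟩

theorem wp_skip : Wp W .skip s Q ↔ Q 1 s := by
  constructor
  · rintro ⟨t, s', h, hq⟩
    cases h
    exact hq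
  · exact fun h => ⟨1, s, .skip s, h⟩

theorem wp_const {x k : ℕ} : Wp W (.const x k) s Q ↔ k ≤ W ∧ Q 1 (s.setVar x k) := by
  constructor
  · rintro ⟨t, s', h, hq⟩
    cases h with
    | const _ _ _ hk => exact ⟨hk, hq⟩
  · exact fun h => ⟨1, _, .const s x k h.1, h.2⟩

theorem wp_copy {x y : ℕ} : Wp W (.copy x y) s Q ↔ Q 1 (s.setVar x (s.var y)) := by
  constructor
  · rintro ⟨t, s', h, hq⟩
    cases h
    exact hq
  · exact fun h => ⟨1, _, .copy s x y, h⟩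

theorem wp_add {x y z : ℕ} : Wp W (.add x y z) s Q ↔
    s.var y + s.var z ≤ W ∧ Q 1 (s.setVar x (s.var y + s.var z)) := by
  constructor
  · rintro ⟨t, s', h, hq⟩
    cases h with
    | add _ _ _ _ hk => exact ⟨hk, hq⟩
  · exact fun h => ⟨1, _, .add s x y z h.1, h.2⟩

theorem wp_sub {x y z : ℕ} : Wp W (.sub x y z) s Q ↔ Q 1 (s.setVar x (s.var y - s.var z)) := by
  constructor
  · rintro ⟨t, s', h, hq⟩
    cases h
    exact hq
  · exact fun h => ⟨1, _, .sub s x y z, h⟩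

theorem wp_load {x a y : ℕ} :
    Wp W (.load x a y) s Q ↔ Q 1 (s.setVar x (s.arr a (s.var y))) := by
  constructor
  · rintro ⟨t, s', h, hq⟩
    cases h
    exact hq
  · exact fun h => ⟨1, _, .load s x a y, h⟩

theorem wp_store {a x y : ℕ} :
    Wp W (.store a x y) s Q ↔ Q 1 (s.setArr a (s.var x) (s.var y)) := by
  constructor
  · rintro ⟨t, s', h, hq⟩
    cases h
    exact hq
  · exact fun h => ⟨1, _, .store s a x y, h⟩

theorem wp_ite {b : Test} : Wp W (.ite b p q) s Q ↔
    (b.Holds s → Wp W p s fun t => Q (t + 1)) ∧ (¬ b.Holds s → Wp W q s fun t => Q (t + 1)) := by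
  constructor
  · rintro ⟨t, s', h, hq⟩
    cases h with
    | ite_true _ _ _ _ _ t hb h => exact ⟨fun _ => ⟨_, _, h, hq⟩, fun hb' => absurd hb hb'⟩
    | ite_false _ _ _ _ _ t hb h => exact ⟨fun hb' => absurd hb' hb, fun _ => ⟨_, _, h, hq⟩⟩
  · rintro ⟨h1, h2⟩
    by_cases hb : b.Holds s
    · obtain ⟨t, s', h, hq⟩ := h1 hb
      exact ⟨_, _, .ite_true _ _ _ _ _ _ hb h, hq⟩
    · obtain ⟨t, s', h, hq⟩ := h2 hb
      exact ⟨_, _, .ite_false _ _ _ _ _ _ hb h, hq⟩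

theorem wp_block_nil : Wp W (block []) s Q ↔ Q 1 s := wp_skip

theorem wp_block_cons {ps : List Prog} : Wp W (block (p :: ps)) s Q ↔
    Wp W p s fun t s' => Wp W (block ps) s' fun t' => Q (t + t') := by
  constructor
  · rintro ⟨t, s', h, hq⟩
    cases h with
    | seq _ _ _ _ _ _ _ h1 h2 => exact ⟨_, _, h1, _, _, h2, hq⟩
  · rintro ⟨t, s', h1, t', s'', h2, hq⟩
    exact ⟨_, _, .seq _ _ _ _ _ _ _ h1 h2, hq⟩

/-- A loop whose body is executed `N` times, with an invariant that counts the iterations. -/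
theorem wp_while {b : Test} (N : ℕ) (I : ℕ → State → Prop) (cost : ℕ → ℕ)
    (hbody : ∀ i < N, ∀ s, I i s →
      b.Holds s ∧ Wp W p s fun t s' => t ≤ cost i ∧ I (i + 1) s')
    (hexit : ∀ s, I N s → ¬ b.Holds s) (h : I 0 s) :
    Wp W (.while b p) s fun t s' => t ≤ ∑ i ∈ Finset.range N, (cost i + 1) + 1 ∧ I N s' := by
  have key : ∀ k ≤ N, ∀ s, I (N - k) s → Wp W (.while b p) s fun t s' =>
      t + ∑ i ∈ Finset.range (N - k), (cost i + 1) ≤ ∑ i ∈ Finset.range N, (cost i + 1) + 1 ∧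
        I N s' := by
    intro k
    induction k with
    | zero =>
      intro _ s hs
      exact ⟨1, s, .while_false b p s (hexit s hs), by rw [Nat.sub_zero, add_comm], hs⟩
    | succ k ih =>
      intro hk s hs
      obtain ⟨hb, t, s', h1, ht, hs'⟩ := hbody (N - (k + 1)) (by omega) s hs
      have hN : N - (k + 1) + 1 = N - k := by omega
      rw [hN] at hs'
      obtain ⟨t', s'', h2, ht', hs''⟩ := ih (by omega) s' hs'
      refine ⟨_, s'', .while_true b p s s' s'' t t' hb h1 h2, ?_, hs''⟩
      rw [← hN, Finset.sum_range_succ] at ht'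
      omega
  have := key N le_rfl s (by rwa [Nat.sub_self])
  simpa using this

end Wp

section State

variable (s : State) (x y k a b i j : ℕ)

theorem State.setVar_var : (s.setVar x k).var y = if y = x then k else s.var y := by
  simp [State.setVar, Function.update_apply]

theorem State.setVar_arr : (s.setVar x k).arr = s.arr := rfl

theorem State.setArr_var : (s.setArr a i k).var = s.var := rfl

theorem State.setArr_arr : (s.setArr a i k).arr b =
    if b = a then Function.update (s.arr a) i k else s.arr b := by
  simp [State.setArr, Function.update_apply]

end State

/-! ### The program

The scalar variables are used as follows: `0` the output; `1` the number `n` of vertices; `2` the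
constant `1`; `3` the position of the next input word; `4` the current vertex `x`; `5` the position
after the neighbours of `x`; `6` a neighbour of `x`; `7` the next unused class name, and later the
largest colour so far; `8` a class; `9` a word read from an array; `10` a new class name, or a
colour; `11` the number `x + 1`; `12` the constant `0`.

The arrays: `0` the input; `1` the class of a vertex; `2` the stamp of a class, which is `x + 1` if
the class has been split by the closed neighbourhood of `x`; `3` the name of the part that has been
split off; `4` the colour of a vertex, `0` if there is none; `5` the stamp of a colour, which is
`x + 1` if a neighbour of `x` has the colour; `6` for a class, whether one of its vertices has a
colour. -/

/-- For each neighbour of the current vertex do `body`. -/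
def forNeighbors (body : Prog) : Prog :=
  .while (.lt 3 5) (block [.load 6 0 3, .add 3 3 2, body])

/-- For each vertex do `body`. -/
def forVertices (body : Prog) : Prog :=
  block [.const 3 1, .const 4 0,
    .while (.lt 4 1) (block [.load 5 0 3, .add 3 3 2, .add 5 3 5, .add 11 4 2, body,
      .copy 3 5, .copy 4 11])]

/-- Move the vertex in variable `6` to the part split off its class. -/
def moveVertex : Prog :=
  block [.load 8 1 6, .load 9 2 8,
    .ite (.eq 9 11) .skip (block [.store 2 8 11, .store 3 8 7, .add 7 7 2]),
    .load 10 3 8, .store 1 6 10]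

/-- Split all classes by the closed neighbourhood of the current vertex. -/
def splitClasses : Prog := block [.copy 6 4, moveVertex, forNeighbors moveVertex]

/-- Stamp the colour of the vertex in variable `6`. -/
def stampColor : Prog := block [.load 9 4 6, .store 5 9 11]

/-- Find the smallest positive colour that is not stamped. -/
def findColor : Prog :=
  block [.copy 10 2, .load 9 5 10, .while (.eq 9 11) (block [.add 10 10 2, .load 9 5 10])]

/-- If no vertex in the class of the current vertex has a colour, give it the smallest colour that
none of its neighbours has. -/
def colorVertex : Prog :=
  block [.load 8 1 4, .load 9 6 8,
    .ite (.eq 9 12)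
      (block [.store 6 8 2, forNeighbors stampColor, findColor, .store 4 4 10,
        .ite (.lt 7 10) (.copy 7 10) .skip])
      .skip]

/-- Split the vertices into the classes of true twins, colour one vertex of each class, and return
`n` minus the number of colours. -/
def smdProg : Prog :=
  block [.const 2 1, .load 1 0 12, .const 7 1, forVertices splitClasses,
    .const 7 0, forVertices colorVertex, .sub 0 1 7]

/-! ### The loops over the input -/

/-- The contents of the registers on which the loops over the input depend. -/
structure Regs (inp : ℕ → ℕ) (n x e : ℕ) (s : State) : Prop where
  inp : s.arr 0 = inp
  num : s.var 1 = n
  one : s.var 2 = 1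
  zero : s.var 12 = 0
  vertex : s.var 4 = x
  listEnd : s.var 5 = e
  stamp : s.var 11 = x + 1

theorem Regs.setVar {inp : ℕ → ℕ} {n x e : ℕ} {s : State} (h : Regs inp n x e s) {y : ℕ}
    (hy : y ∉ [1, 2, 12, 4, 5, 11]) (k : ℕ) : Regs inp n x e (s.setVar y k) := by
  simp only [List.mem_cons, List.not_mem_nil, or_false, not_or, ← ne_eq] at hy
  obtain ⟨h1, h2, h3, h4, h5, h6⟩ := hy
  constructor <;>
    simp only [State.setVar_var, State.setVar_arr, h1.symm, h2.symm, h3.symm, h4.symm, h5.symm,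
      h6.symm, if_false]
  exacts [h.inp, h.num, h.one, h.zero, h.vertex, h.listEnd, h.stamp]

theorem Regs.setArr {inp : ℕ → ℕ} {n x e : ℕ} {s : State} (h : Regs inp n x e s) {a : ℕ}
    (ha : a ≠ 0) (i k : ℕ) : Regs inp n x e (s.setArr a i k) := by
  refine ⟨?_, h.num, h.one, h.zero, h.vertex, h.listEnd, h.stamp⟩
  rw [State.setArr_arr, if_neg ha.symm, h.inp]

/-- The invariant `P` speaks of the arrays and of variable `7`; its first argument is the number of
neighbours that have been treated. -/
theorem wp_forNeighbors {W n x p : ℕ} {inp : ℕ → ℕ} {body : Prog} {l : List ℕ}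
    {P : ℕ → (ℕ → ℕ → ℕ) → ℕ → Prop} (cost : ℕ)
    (hW : p + l.length ≤ W) (hinp : ∀ i (h : i < l.length), inp (p + i) = l[i])
    (hbody : ∀ i (h : i < l.length), ∀ q s, Regs inp n x (p + l.length) s → s.var 3 = q →
      s.var 6 = l[i] → P i s.arr (s.var 7) → Wp W body s fun t s' =>
        t ≤ cost ∧ Regs inp n x (p + l.length) s' ∧ s'.var 3 = q ∧ P (i + 1) s'.arr (s'.var 7))
    {s : State} (hs : Regs inp n x (p + l.length) s) (hp : s.var 3 = p)
    (hP : P 0 s.arr (s.var 7)) :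
    Wp W (forNeighbors body) s fun t s' => t ≤ (cost + 4) * l.length + 1 ∧
      Regs inp n x (p + l.length) s' ∧ P l.length s'.arr (s'.var 7) := by
  refine (wp_while l.length (fun i s => Regs inp n x (p + l.length) s ∧ s.var 3 = p + i ∧
    P i s.arr (s.var 7)) (fun _ => cost + 3) ?_ ?_ ⟨hs, hp, hP⟩).mono ?_
  · rintro i hi s ⟨hs, hpi, hP⟩
    refine ⟨?_, ?_⟩
    · rw [Test.Holds, hs.listEnd, hpi]; omega
    · simp only [wp_block_cons, wp_block_nil, wp_load, wp_add]
      refine ⟨by simp [State.setVar_var, hpi, hs.one]; omega, ?_⟩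
      refine (hbody i hi (p + (i + 1)) _ ((hs.setVar (by simp) _).setVar (by simp) _) ?_ ?_ ?_).mono
        ?_
      · simp [State.setVar_var, hpi, hs.one, add_assoc]
      · simp [State.setVar_var, hpi, hs.inp, hinp i hi]
      · simpa [State.setVar_var, State.setVar_arr] using hP
      · rintro t s' ⟨ht, h⟩
        exact ⟨by omega, h⟩
  · rintro s ⟨hs, hpi, -⟩
    rw [Test.Holds, hs.listEnd, hpi]; omega
  · rintro t s' ⟨ht, h1, -, h2⟩
    refine ⟨ht.trans (le_of_eq ?_), h1, h2⟩
    simp [mul_comm]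

/-- The position in the input of the degree of vertex `x`. -/
def offset (nb : ℕ → List ℕ) (x : ℕ) : ℕ := 1 + ∑ y ∈ Finset.range x, ((nb y).length + 1)

/-- The invariant `P` speaks of the arrays and of variable `7`; its first argument is the number of
vertices that have been treated. -/
theorem wp_forVertices {W n : ℕ} {inp : ℕ → ℕ} {nb : ℕ → List ℕ} {body : Prog}
    {P : ℕ → (ℕ → ℕ → ℕ) → ℕ → Prop} (a b : ℕ)
    (hW : offset nb n ≤ W) (hdeg : ∀ x < n, inp (offset nb x) = (nb x).length)
    (hbody : ∀ x < n, ∀ p, p = offset nb x + 1 → p + (nb x).length ≤ W →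
      ∀ s, Regs inp n x (p + (nb x).length) s → s.var 3 = p →
      P x s.arr (s.var 7) → Wp W body s fun t s' => t ≤ a + b * (nb x).length ∧
        Regs inp n x (p + (nb x).length) s' ∧ P (x + 1) s'.arr (s'.var 7))
    {s : State} (hinp : s.arr 0 = inp) (hn : s.var 1 = n) (h1 : s.var 2 = 1) (h0 : s.var 12 = 0)
    (hP : P 0 s.arr (s.var 7)) :
    Wp W (forVertices body) s fun t s' => t ≤ (a + b + 8) * (offset nb n) + 4 ∧
      s'.arr 0 = inp ∧ s'.var 1 = n ∧ s'.var 2 = 1 ∧ s'.var 12 = 0 ∧ P n s'.arr (s'.var 7) := by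
  have hmono : ∀ x < n, offset nb x + 1 + (nb x).length ≤ offset nb n := by
    intro x hx
    have : offset nb (x + 1) ≤ offset nb n :=
      Nat.add_le_add_left (Finset.sum_le_sum_of_subset (Finset.range_subset_range.2 hx)) 1
    rw [offset, Finset.sum_range_succ] at this
    rw [offset]
    omega
  have hn' : n + 1 ≤ offset nb n := by
    have : ∑ y ∈ Finset.range n, 1 ≤ ∑ y ∈ Finset.range n, ((nb y).length + 1) :=
      Finset.sum_le_sum fun _ _ => by omega
    simp only [Finset.sum_const, Finset.card_range, smul_eq_mul, mul_one] at this
    rw [offset]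
    omega
  rw [forVertices]
  simp only [wp_block_cons, wp_block_nil, wp_const]
  refine ⟨by omega, by omega, ?_⟩
  refine (wp_while n (fun x s => s.arr 0 = inp ∧ s.var 1 = n ∧ s.var 2 = 1 ∧ s.var 12 = 0 ∧
    s.var 4 = x ∧ s.var 3 = offset nb x ∧ P x s.arr (s.var 7))
    (fun x => a + b * (nb x).length + 7) ?_ ?_ ?_).mono ?_
  · rintro x hx s ⟨hinp, hn, h1, h0, h4, h3, hP⟩
    have hmx := hmono x hx
    refine ⟨by rw [Test.Holds, h4, hn]; exact hx, ?_⟩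
    simp only [wp_block_cons, wp_block_nil, wp_load, wp_add, wp_copy]
    simp only [State.setVar_var, State.setVar_arr, h1, h3, h4, hinp, hdeg x hx]
    norm_num
    refine ⟨by omega, by omega, by omega, ?_⟩
    refine (hbody x hx _ rfl (by omega) _ ⟨?_, ?_, ?_, ?_, ?_, ?_, ?_⟩ ?_ ?_).mono ?_
    · simp [State.setVar_arr, hinp]
    · simp [State.setVar_var, hn]
    · simp [State.setVar_var, h1]
    · simp [State.setVar_var, h0]
    · simp [State.setVar_var, h4]
    · simp [State.setVar_var]
    · simp [State.setVar_var]
    · simp [State.setVar_var]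
    · simpa [State.setVar_var, State.setVar_arr] using hP
    · rintro t s' ⟨ht, hs, hP'⟩
      refine ⟨by omega, hs.inp, hs.num, hs.one, hs.zero, hs.stamp, ?_, hP'⟩
      rw [hs.listEnd, offset, offset, Finset.sum_range_succ]
      omega
  · rintro s ⟨-, hn, -, -, h4, -⟩
    rw [Test.Holds, hn, h4]; omega
  · simp [State.setVar_var, State.setVar_arr, hinp, hn, h1, h0, offset]
    exact hP
  · rintro t s' ⟨ht, hinp, hn, h1, h0, -, -, hP⟩
    refine ⟨?_, hinp, hn, h1, h0, hP⟩
    have hsum : ∑ x ∈ Finset.range n, (a + b * (nb x).length + 7 + 1) ≤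
        ∑ x ∈ Finset.range n, (a + b + 8) * ((nb x).length + 1) := by
      refine Finset.sum_le_sum fun x _ => ?_
      nlinarith [Nat.zero_le (a * (nb x).length), Nat.zero_le b]
    rw [← Finset.mul_sum] at hsum
    have : (a + b + 8) * offset nb n =
        (a + b + 8) + (a + b + 8) * ∑ y ∈ Finset.range n, ((nb y).length + 1) := by
      rw [offset, mul_add, mul_one]
    omega

end RAM

/-! ### Partition refinement -/

namespace RAM

/-- The state of the arrays and of the fresh class name `f` while the classes `cls`, whose names
are less than `f₀`, are split by a set of which the vertices in `D` have been treated. -/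
structure Splitting (x f₀ : ℕ) (cls : ℕ → ℕ) (D : Set ℕ) (k : ℕ) (arr : ℕ → ℕ → ℕ) (f : ℕ) :
    Prop where
  untouched : ∀ v ∉ D, arr 1 v = cls v
  touched : ∀ v ∈ D, arr 2 (cls v) = x + 1 ∧ arr 1 v = arr 3 (cls v)
  fresh : ∀ c, arr 2 c = x + 1 → f₀ ≤ arr 3 c ∧ arr 3 c < f
  inj : ∀ c d, arr 2 c = x + 1 → arr 2 d = x + 1 → arr 3 c = arr 3 d → c = d
  stamp_le : ∀ c, arr 2 c ≤ x + 1
  le_fresh : f₀ ≤ f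
  fresh_le : f ≤ f₀ + k
  blank : ∀ a, 4 ≤ a → ∀ i, arr a i = 0

theorem wp_moveVertex {W n x e f₀ v k p : ℕ} {inp cls : ℕ → ℕ} {D : Set ℕ} {s : State}
    (hW : s.var 7 + 1 ≤ W) (hs : Regs inp n x e s) (hp : s.var 3 = p) (hv : s.var 6 = v)
    (hvD : v ∉ D) (h : Splitting x f₀ cls D k s.arr (s.var 7)) :
    Wp W moveVertex s fun t s' => t ≤ 10 ∧ Regs inp n x e s' ∧ s'.var 3 = p ∧
      Splitting x f₀ cls (insert v D) (k + 1) s'.arr (s'.var 7) := by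
  have hcls : s.arr 1 v = cls v := h.untouched v hvD
  have hstamp := hs.stamp
  have hone := hs.one
  simp only [moveVertex, wp_block_cons, wp_block_nil, wp_load, wp_store, wp_ite, wp_skip, wp_add,
    Test.Holds]
  simp only [State.setVar_var, State.setVar_arr, State.setArr_arr, State.setArr_var, hv, hcls,
    hstamp, hone, Nat.reduceEqDiff, if_true, if_false]
  refine ⟨fun hm => ⟨by norm_num, ?_, hp, ?_⟩, fun hm => ⟨hW, by norm_num, ?_, hp, ?_⟩⟩
  · exact ((((hs.setVar (by simp) _).setVar (by simp) _).setVar (by simp) _).setArr (by simp) _ _)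
  · refine ⟨?_, ?_, ?_, ?_, ?_, h.le_fresh, h.fresh_le.trans (by omega), ?_⟩ <;>
      simp only [State.setVar_arr, State.setArr_arr, Nat.reduceEqDiff, if_true, if_false]
    · intro u hu
      rw [Set.mem_insert_iff, not_or] at hu
      simp [hu.1, h.untouched u hu.2]
    · rintro u (rfl | hu)
      · simp [hm]
      · have huv : u ≠ v := fun h => hvD (h ▸ hu)
        simpa [Function.update_apply, huv] using h.touched u hu
    · simpa using h.fresh
    · simpa using h.inj
    · simpa using h.stamp_le
    · intro a ha i
      have h1 : a ≠ 1 := by omega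
      simp [h1, h.blank a ha]
  · exact (((((((hs.setVar (by simp) _).setVar (by simp) _).setArr (by simp) _ _).setArr
      (by simp) _ _).setVar (by simp) _).setVar (by simp) _).setArr (by simp) _ _)
  · have hnot : ∀ c, s.arr 2 c = x + 1 → c ≠ cls v := fun c hc h => hm (h ▸ hc)
    refine ⟨?_, ?_, ?_, ?_, ?_, h.le_fresh.trans (Nat.le_succ _),
        Nat.succ_le_succ h.fresh_le, ?_⟩ <;>
      simp only [State.setVar_arr, State.setArr_arr, Nat.reduceEqDiff, if_true, if_false]
    · intro u hu
      rw [Set.mem_insert_iff, not_or] at hu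
      simp [hu.1, h.untouched u hu.2]
    · rintro u (rfl | hu)
      · simp
      · have huv : u ≠ v := fun h => hvD (h ▸ hu)
        have hu' := h.touched u hu
        have := hnot _ hu'.1
        simpa [Function.update_apply, huv, this] using hu'
    · intro c
      have h1 := h.fresh c
      have h2 := h.le_fresh
      by_cases hc : c = cls v
      · simpa [hc] using h2
      · simp only [Function.update_apply, hc, if_false]
        omega
    · intro c d
      have h1 := h.fresh c
      have h2 := h.fresh d
      have h3 := h.inj c d
      by_cases hc : c = cls v <;> by_cases hd : d = cls v
      · exact fun _ _ _ => hc.trans hd.symm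
      all_goals simp only [Function.update_apply, hc, hd, if_true, if_false]; omega
    · intro c
      have h1 := h.stamp_le c
      by_cases hc : c = cls v <;>
        simp only [Function.update_apply, hc, if_true, if_false] <;> omega
    · intro a ha i
      have h1 : a ≠ 1 := by omega
      have h2 : a ≠ 2 := by omega
      have h3 : a ≠ 3 := by omega
      simp [h1, h2, h3, h.blank a ha]

/-- The state of the arrays and of the fresh class name `f` when the vertices less than `x` have
been used to split the classes. -/
structure Refined (nb : ℕ → List ℕ) (x : ℕ) (arr : ℕ → ℕ → ℕ) (f : ℕ) : Prop where
  cls_eq_iff : ∀ u v, arr 1 u = arr 1 v ↔ ∀ y < x, u ∈ y :: nb y ↔ v ∈ y :: nb y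
  cls_lt : ∀ v, arr 1 v < f
  stamp_le : ∀ c, arr 2 c ≤ x
  fresh_le : f ≤ offset nb x
  blank : ∀ a, 4 ≤ a → ∀ i, arr a i = 0

theorem offset_succ (nb : ℕ → List ℕ) (x : ℕ) :
    offset nb (x + 1) = offset nb x + ((nb x).length + 1) := by
  rw [offset, offset, Finset.sum_range_succ, add_assoc]

theorem Refined.succ {nb : ℕ → List ℕ} {x f₀ f : ℕ} {arr₀ arr : ℕ → ℕ → ℕ}
    (h₀ : Refined nb x arr₀ f₀)
    (h : Splitting x f₀ (arr₀ 1) {v | v ∈ x :: nb x} ((nb x).length + 1) arr f) :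
    Refined nb (x + 1) arr f := by
  have hlt : ∀ v, arr 1 v < f := by
    intro v
    by_cases hv : v ∈ x :: nb x
    · obtain ⟨h1, h2⟩ := h.touched v hv
      rw [h2]
      exact (h.fresh _ h1).2
    · rw [h.untouched v hv]
      exact (h₀.cls_lt v).trans_le h.le_fresh
  have hne : ∀ u v, u ∈ x :: nb x → v ∉ x :: nb x → arr 1 u ≠ arr 1 v := by
    intro u v hu hv
    obtain ⟨h1, h2⟩ := h.touched u hu
    rw [h2, h.untouched v hv]
    have := (h.fresh _ h1).1
    have := h₀.cls_lt v
    omega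
  refine ⟨fun u v => ?_, hlt, h.stamp_le, ?_, h.blank⟩
  · rw [Nat.forall_lt_succ_right, ← h₀.cls_eq_iff u v]
    by_cases hu : u ∈ x :: nb x <;> by_cases hv : v ∈ x :: nb x
    · obtain ⟨h1, h2⟩ := h.touched u hu
      obtain ⟨h3, h4⟩ := h.touched v hv
      have : arr 1 u = arr 1 v ↔ arr₀ 1 u = arr₀ 1 v := by
        rw [h2, h4]
        exact ⟨h.inj _ _ h1 h3, fun h => by rw [h]⟩
      simp only [hu, hv, this, and_true]
    · simp only [hu, hv, hne u v hu hv, iff_false, not_true, and_false]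
    · simp only [hu, hv, (hne v u hv hu).symm, iff_true, and_false]
    · rw [h.untouched u hu, h.untouched v hv]
      simp only [hu, hv, and_true]
  · have := h.fresh_le
    have := h₀.fresh_le
    rw [offset_succ]
    omega

theorem wp_splitClasses {W n x p : ℕ} {inp : ℕ → ℕ} {nb : ℕ → List ℕ} {s : State}
    (hW : offset nb (x + 1) ≤ W) (hx : x ∉ nb x) (hnd : (nb x).Nodup)
    (hinp : ∀ i (h : i < (nb x).length), inp (p + i) = (nb x)[i]) (hpW : p + (nb x).length ≤ W)
    (hs : Regs inp n x (p + (nb x).length) s) (hp : s.var 3 = p)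
    (h : Refined nb x s.arr (s.var 7)) :
    Wp W splitClasses s fun t s' => t ≤ 13 + 14 * (nb x).length ∧
      Regs inp n x (p + (nb x).length) s' ∧ Refined nb (x + 1) s'.arr (s'.var 7) := by
  generalize hf₀ : s.var 7 = f₀ at h
  generalize harr₀ : s.arr = arr₀ at h
  rw [offset_succ] at hW
  have hfle := h.fresh_le
  have h0 : Splitting x f₀ (arr₀ 1) ∅ 0 arr₀ f₀ := by
    have hne : ∀ c, arr₀ 2 c ≠ x + 1 := fun c => by have := h.stamp_le c; omega
    exact ⟨fun _ _ => rfl, fun _ h => h.elim, fun c hc => absurd hc (hne c),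
      fun c _ hc => absurd hc (hne c), fun c => (h.stamp_le c).trans (Nat.le_succ x), le_rfl,
      le_rfl, h.blank⟩
  simp only [splitClasses, wp_block_cons, wp_block_nil, wp_copy]
  refine (wp_moveVertex (v := x) (k := 0) (D := ∅) ?_ (hs.setVar (by simp) _) (p := p) ?_ ?_
    (Set.notMem_empty x) (f₀ := f₀) (cls := arr₀ 1) ?_).mono ?_
  · simp only [State.setVar_var, hf₀, Nat.reduceEqDiff, if_false]
    omega
  · simpa [State.setVar_var] using hp
  · simpa [State.setVar_var] using hs.vertex
  · simpa [State.setVar_var, State.setVar_arr, harr₀, hf₀] using h0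
  rintro t₁ s₁ ⟨ht₁, hs₁, hp₁, h₁⟩
  refine (wp_forNeighbors (P := fun i arr f => Splitting x f₀ (arr₀ 1)
    {v | v ∈ x :: (nb x).take i} (i + 1) arr f) 10 hpW hinp ?_ hs₁ hp₁ ?_).mono ?_
  · intro i hi q s hs hq hv hP
    have hnotin : (nb x)[i] ∉ ({v | v ∈ x :: (nb x).take i} : Set ℕ) := by
      simp only [Set.mem_ofPred_eq, List.mem_cons, not_or]
      refine ⟨fun h => hx ?_, fun h => ?_⟩
      · have := List.getElem_mem hi
        rwa [h] at this
      · obtain ⟨j, hj, hji⟩ := List.mem_take_iff_getElem.1 h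
        have := (hnd.getElem_inj_iff).1 hji
        omega
    have hle := hP.fresh_le
    refine (wp_moveVertex (by omega) hs hq hv hnotin hP).mono ?_
    rintro t s' ⟨ht, hs', hq', h'⟩
    refine ⟨ht, hs', hq', ?_⟩
    convert h' using 1
    ext v
    simp only [List.take_add_one, List.getElem?_eq_getElem hi, Set.mem_ofPred_eq, List.mem_cons,
      List.mem_append, Option.toList_some, Set.mem_insert_iff, List.not_mem_nil, or_false]
    tauto
  · convert h₁ using 1
    ext v
    simp
  · rintro t₂ s₂ ⟨ht₂, hs₂, h₂⟩
    rw [List.take_length] at h₂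
    exact ⟨by omega, hs₂, h.succ h₂⟩

/-! ### First-fit colouring of one vertex of each class -/

/-- The state of the arrays and of the largest colour `k` when the vertices less than `x` have been
treated; `cls v` is the class of `v`. -/
structure Colored (nb : ℕ → List ℕ) (cls : ℕ → ℕ) (x : ℕ) (arr : ℕ → ℕ → ℕ) (k : ℕ) : Prop where
  cls_eq : arr 1 = cls
  stamp_le : ∀ c, arr 5 c ≤ x
  seen : ∀ c, arr 6 c ≠ 0 ↔ ∃ u, arr 4 u ≠ 0 ∧ cls u = c
  lt : ∀ u, arr 4 u ≠ 0 → u < x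
  exists_rep : ∀ u < x, ∃ w, arr 4 w ≠ 0 ∧ cls w = cls u
  rep_unique : ∀ u v, arr 4 u ≠ 0 → arr 4 v ≠ 0 → cls u = cls v → u = v
  proper : ∀ u v, v ∈ nb u → arr 4 u ≠ 0 → arr 4 u ≠ arr 4 v
  fit : ∀ u j, j ≠ 0 → j < arr 4 u → ∃ w ∈ nb u, arr 4 w = j
  le : ∀ u, arr 4 u ≤ k
  attained : k = 0 ∨ ∃ u, arr 4 u = k

/-- Giving the vertex `x` the smallest positive colour `j` that does not occur at its
neighbours. -/
theorem Colored.succ {nb : ℕ → List ℕ} {cls : ℕ → ℕ} {x k j : ℕ} {arr arr' : ℕ → ℕ → ℕ}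
    (h : Colored nb cls x arr k) (hsymm : ∀ u v, u ∈ nb v → v ∈ nb u) (hirr : x ∉ nb x)
    (hseen : arr 6 (cls x) = 0) (hj0 : j ≠ 0) (hjfree : ∀ w ∈ nb x, arr 4 w ≠ j)
    (hjfit : ∀ i, i ≠ 0 → i < j → ∃ w ∈ nb x, arr 4 w = i)
    (h1 : arr' 1 = arr 1) (h4 : arr' 4 = Function.update (arr 4) x j)
    (h5 : ∀ c, arr' 5 c ≤ x + 1) (h6 : arr' 6 = Function.update (arr 6) (cls x) 1) :
    Colored nb cls (x + 1) arr' (max k j) := by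
  have hx0 : arr 4 x = 0 := by
    by_contra hx0
    exact lt_irrefl x (h.lt x hx0)
  have hcol : ∀ u, arr' 4 u = if u = x then j else arr 4 u := fun u => by
    rw [h4, Function.update_apply]
  have hnocls : ∀ u, arr 4 u ≠ 0 → cls u ≠ cls x := fun u hu hc =>
    (h.seen (cls x)).2 ⟨u, hu, hc⟩ hseen
  have hne : ∀ u, arr 4 u ≠ 0 → u ≠ x := fun u hu hux => hu (hux ▸ hx0)
  refine ⟨h1.trans h.cls_eq, h5, fun c => ?_, fun u => ?_, fun u hu => ?_, fun u v => ?_,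
    fun u v huv => ?_, fun u i hi hiu => ?_, fun u => ?_, Or.inr ?_⟩
  · rw [h6, Function.update_apply]
    split_ifs with hc
    · exact ⟨fun _ => ⟨x, by rw [hcol, if_pos rfl]; exact hj0, hc.symm⟩, fun _ => one_ne_zero⟩
    · rw [h.seen]
      constructor
      · rintro ⟨u, hu, hcu⟩
        exact ⟨u, by rwa [hcol, if_neg (hne u hu)], hcu⟩
      · rintro ⟨u, hu, hcu⟩
        have hux : u ≠ x := fun hux => hc (hux ▸ hcu.symm)
        exact ⟨u, by rwa [hcol, if_neg hux] at hu, hcu⟩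
  · rw [hcol]
    split_ifs with hux
    · omega
    · exact fun hu => (h.lt u hu).trans (Nat.lt_succ_self x)
  · by_cases hux : u = x
    · exact ⟨x, by rw [hcol, if_pos rfl]; exact hj0, by rw [hux]⟩
    · obtain ⟨w, hw, hcw⟩ := h.exists_rep u (by omega)
      exact ⟨w, by rwa [hcol, if_neg (hne w hw)], hcw⟩
  · rw [hcol, hcol]
    split_ifs with hu hv hv
    · exact fun _ _ _ => hu.trans hv.symm
    · exact fun _ hv' hc => absurd (hu ▸ hc.symm) (hnocls v hv')
    · exact fun hu' _ hc => absurd (hv ▸ hc) (hnocls u hu')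
    · exact h.rep_unique u v
  · rw [hcol, hcol]
    split_ifs with hu hv hv
    · subst hu hv
      exact absurd huv hirr
    · subst hu
      exact fun _ => (hjfree v huv).symm
    · subst hv
      exact fun _ => hjfree u (hsymm _ _ huv)
    · exact h.proper u v huv
  · have hlift : ∀ w, arr 4 w = i → arr' 4 w = i := fun w hw => by
      rw [hcol, if_neg (hne w (hw ▸ hi)), hw]
    rw [hcol] at hiu
    split_ifs at hiu with hu
    · subst hu
      obtain ⟨w, hw, hwi⟩ := hjfit i hi hiu
      exact ⟨w, hw, hlift w hwi⟩
    · obtain ⟨w, hw, hwi⟩ := h.fit u i hi hiu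
      exact ⟨w, hw, hlift w hwi⟩
  · rw [hcol]
    split_ifs
    · exact le_max_right _ _
    · exact (h.le u).trans (le_max_left _ _)
  · rcases le_total k j with hkj | hkj
    · exact ⟨x, by rw [hcol, if_pos rfl, max_eq_right hkj]⟩
    · rw [max_eq_left hkj]
      rcases h.attained with h0 | ⟨u, hu⟩
      · omega
      · by_cases hk : k = 0
        · omega
        · exact ⟨u, by rw [hcol, if_neg (hne u (hu ▸ hk)), hu]⟩

/-- A vertex whose class already has a coloured vertex stays without colour. -/
theorem Colored.skip {nb : ℕ → List ℕ} {cls : ℕ → ℕ} {x k : ℕ} {arr : ℕ → ℕ → ℕ}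
    (h : Colored nb cls x arr k) (hseen : arr 6 (cls x) ≠ 0) : Colored nb cls (x + 1) arr k := by
  refine ⟨h.cls_eq, fun c => (h.stamp_le c).trans (Nat.le_succ x), h.seen,
    fun u hu => (h.lt u hu).trans (Nat.lt_succ_self x), fun u hu => ?_, h.rep_unique, h.proper,
    h.fit, h.le, h.attained⟩
  rcases Nat.lt_succ_iff_lt_or_eq.1 hu with hu | rfl
  · exact h.exists_rep u hu
  · exact (h.seen _).1 hseen

/-- Among the colours `1, …, l.length + 1` one is not stamped, because each stamp comes from an
element of `l`. -/
theorem exists_least_unstamped (l : List ℕ) (col used : ℕ → ℕ) (y : ℕ)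
    (h : ∀ c, used c = y ↔ ∃ w ∈ l, col w = c) :
    ∃ j, j ≠ 0 ∧ j ≤ l.length + 1 ∧ used j ≠ y ∧ ∀ i, i ≠ 0 → i < j → used i = y := by
  classical
  have hex : ∃ j, j ≠ 0 ∧ used j ≠ y ∧ j ≤ l.length + 1 := by
    by_contra hcon
    push Not at hcon
    have hsub : Finset.Icc 1 (l.length + 1) ⊆ (l.map col).toFinset := by
      intro j hj
      rw [Finset.mem_Icc] at hj
      have : used j = y := by
        by_contra hne
        have := hcon j (by omega) hne
        omega
      simpa using (h j).1 this
    have h1 := Finset.card_le_card hsub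
    have h2 := (l.map col).toFinset_card_le
    rw [Nat.card_Icc] at h1
    rw [List.length_map] at h2
    omega
  obtain ⟨h0, h1, h2⟩ := Nat.find_spec hex
  refine ⟨Nat.find hex, h0, h2, h1, fun i hi hij => ?_⟩
  by_contra hne
  exact Nat.find_min hex hij ⟨hi, hne, by omega⟩

theorem wp_findColor {W n x e j : ℕ} {inp : ℕ → ℕ} {arr : ℕ → ℕ → ℕ} {k : ℕ} {s : State}
    (hjW : j ≤ W) (hj0 : j ≠ 0) (hj : arr 5 j ≠ x + 1) (hmin : ∀ i, i ≠ 0 → i < j → arr 5 i = x + 1)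
    (hs : Regs inp n x e s) (harr : s.arr = arr) (hk : s.var 7 = k) :
    Wp W findColor s fun t s' => t ≤ 4 * j ∧ Regs inp n x e s' ∧ s'.arr = arr ∧ s'.var 7 = k ∧
      s'.var 10 = j := by
  simp only [findColor, wp_block_cons, wp_block_nil, wp_load, wp_copy]
  refine (wp_while (j - 1) (fun i s => Regs inp n x e s ∧ s.arr = arr ∧ s.var 7 = k ∧
    s.var 10 = i + 1 ∧ s.var 9 = arr 5 (i + 1)) (fun _ => 3) ?_ ?_ ?_).mono ?_
  · rintro i hi s ⟨hs, harr, hk, h10, h9⟩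
    refine ⟨by rw [Test.Holds, h9, hs.stamp]; exact hmin _ (by omega) (by omega), ?_⟩
    simp only [wp_block_cons, wp_block_nil, wp_load, wp_add]
    refine ⟨by rw [h10, hs.one]; omega, by omega, (hs.setVar (by simp) _).setVar (by simp) _, ?_⟩
    simp [State.setVar_var, State.setVar_arr, h10, hs.one, harr, hk]
  · rintro s ⟨hs, -, -, -, h9⟩
    rw [Test.Holds, h9, hs.stamp, Nat.sub_add_cancel (by omega)]
    exact hj
  · refine ⟨(hs.setVar (by simp) _).setVar (by simp) _, ?_⟩
    simp [State.setVar_var, State.setVar_arr, hs.one, harr, hk]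
  · rintro t s' ⟨ht, hs', harr', hk', h10, -⟩
    simp only [Finset.sum_const, Finset.card_range, smul_eq_mul] at ht
    exact ⟨by omega, hs', harr', hk', by omega⟩

theorem wp_colorVertex {W n x p : ℕ} {inp cls : ℕ → ℕ} {nb : ℕ → List ℕ} {s : State}
    (hsymm : ∀ u v, u ∈ nb v → v ∈ nb u) (hirr : x ∉ nb x)
    (hinp : ∀ i (h : i < (nb x).length), inp (p + i) = (nb x)[i]) (hp1 : 1 ≤ p)
    (hpW : p + (nb x).length ≤ W)
    (hs : Regs inp n x (p + (nb x).length) s) (hp : s.var 3 = p)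
    (h : Colored nb cls x s.arr (s.var 7)) :
    Wp W colorVertex s fun t s' => t ≤ 18 + 11 * (nb x).length ∧
      Regs inp n x (p + (nb x).length) s' ∧ Colored nb cls (x + 1) s'.arr (s'.var 7) := by
  generalize hk : s.var 7 = k at h
  generalize harr : s.arr = arr at h
  have hvx := hs.vertex
  have hzero := hs.zero
  have hone := hs.one
  simp only [colorVertex, wp_block_cons, wp_block_nil, wp_load, wp_ite, wp_skip, wp_store,
    Test.Holds]
  simp only [State.setVar_var, State.setVar_arr, State.setArr_var, harr, hvx,
    hone, hzero, h.cls_eq, Nat.reduceEqDiff, if_true, if_false]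
  refine ⟨fun hseen => ?_, fun hseen => ?_⟩
  swap
  · exact ⟨by omega, (hs.setVar (by simp) _).setVar (by simp) _, by rw [hk]; exact h.skip hseen⟩
  -- `stampColor` writes to array `5` only.
  refine (wp_forNeighbors (n := n) (x := x) (inp := inp) (P := fun i arr' k' => k' = k ∧
    (∀ c, arr' 5 c ≤ x + 1) ∧ (∀ c, arr' 5 c = x + 1 ↔ ∃ w ∈ (nb x).take i, arr 4 w = c) ∧
    arr' 1 = arr 1 ∧ arr' 4 = arr 4 ∧ arr' 6 = Function.update (arr 6) (cls x) 1) 3 hpW hinp ?_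
    (((hs.setVar (by simp) _).setVar (by simp) _).setArr (by simp) _ _) ?_ ?_).mono ?_
  · rintro i hi q s hs hq hv ⟨hk', hle, hstamp, h1, h4, h6⟩
    have hst := hs.stamp
    simp only [stampColor, wp_block_cons, wp_block_nil, wp_load, wp_store]
    refine ⟨by omega, (hs.setVar (by simp) _).setArr (by simp) _ _, hq, ?_⟩
    simp only [State.setVar_var, State.setVar_arr, State.setArr_arr, State.setArr_var,
      Nat.reduceEqDiff, if_true, if_false, hv, hst, h4, h1, h6, hk', Function.update_apply,
      true_and, and_true]
    refine ⟨fun c => ?_, fun c => ?_⟩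
    · split_ifs
      · exact le_rfl
      · exact hle c
    · simp only [List.take_add_one, List.getElem?_eq_getElem hi, List.mem_append,
        Option.toList_some, List.mem_singleton, or_and_right, exists_or, exists_eq_left,
        ← hstamp]
      split_ifs with hc
      · simp [hc]
      · simp [Ne.symm hc]
  · simpa [State.setVar_var, State.setArr_var] using hp
  · have hne : ∀ c, arr 5 c ≠ x + 1 := fun c => by have := h.stamp_le c; omega
    simp only [State.setVar_var, State.setVar_arr, State.setArr_arr, State.setArr_var, harr, hk,
      Nat.reduceEqDiff, if_true, if_false, h.cls_eq, true_and, List.take_zero,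
      List.not_mem_nil, false_and, exists_false, hne, and_true, implies_true]
    exact fun c => (h.stamp_le c).trans (Nat.le_succ x)
  rintro t₁ s₁ ⟨ht₁, hs₁, hk₁, hle, hstamp, h1, h4, h6⟩
  rw [List.take_length] at hstamp
  obtain ⟨j, hj0, hjle, hjne, hjmin⟩ := exists_least_unstamped (nb x) (arr 4) (s₁.arr 5) _ hstamp
  refine (wp_findColor (W := W) (by omega) hj0 hjne hjmin hs₁ rfl hk₁).mono ?_
  rintro t₂ s₂ ⟨ht₂, hs₂, harr₂, hk₂, hj₂⟩
  have hvx₂ := hs₂.vertex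
  have hnew : Colored nb cls (x + 1) (s₂.setArr 4 x j).arr (max k j) := by
    refine h.succ hsymm hirr hseen hj0 (fun w hw hwj => hjne ((hstamp j).2 ⟨w, hw, hwj⟩))
      (fun i hi hij => (hstamp i).1 (hjmin i hi hij)) ?_ ?_ ?_ ?_ <;>
      simp only [State.setArr_arr, harr₂, Nat.reduceEqDiff, if_true, if_false, h1, h4, h6]
    exact hle
  simp only [wp_copy, hvx₂, hj₂, hk₂, State.setVar_arr, State.setVar_var, if_true]
  refine ⟨fun hlt => ⟨by omega, (hs₂.setArr (by simp) _ _).setVar (by simp) _, ?_⟩,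
    fun hlt => ⟨by omega, hs₂.setArr (by simp) _ _, ?_⟩⟩
  · rw [max_eq_right hlt.le] at hnew
    simpa only [State.setArr_var, hj₂] using hnew
  · rwa [max_eq_left (not_lt.1 hlt)] at hnew

/-! ### Correctness of the program -/

/-- The input is given through the lengths and entries of the lists `nb 0, …, nb (n - 1)`. The
final colouring is a first-fit colouring of one vertex of each class. -/
theorem wp_smdProg {W n : ℕ} {inp : ℕ → ℕ} {nb : ℕ → List ℕ} {s : State}
    (hW : offset nb n ≤ W) (hn : inp 0 = n)
    (hdeg : ∀ x < n, inp (offset nb x) = (nb x).length)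
    (hinp : ∀ x < n, ∀ i (h : i < (nb x).length), inp (offset nb x + 1 + i) = (nb x)[i])
    (hsymm : ∀ u v, u ∈ nb v → v ∈ nb u) (hirr : ∀ x, x ∉ nb x) (hnd : ∀ x, (nb x).Nodup)
    (hs : s.arr 0 = inp) (hs0 : ∀ a, a ≠ 0 → ∀ i, s.arr a i = 0) (hv : ∀ y, s.var y = 0) :
    Wp W smdProg s fun t s' => t ≤ 100 * offset nb n ∧ ∃ cls arr k, s'.output = n - k ∧
      (∀ u v, cls u = cls v ↔ ∀ y < n, u ∈ y :: nb y ↔ v ∈ y :: nb y) ∧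
      Colored nb cls n arr k := by
  have hoff : 1 ≤ offset nb n := by rw [offset]; omega
  simp only [smdProg, wp_block_cons, wp_block_nil, wp_load, wp_const]
  refine ⟨by omega, by omega, ?_⟩
  refine (wp_forVertices (P := Refined nb) 13 14 hW hdeg ?_ (by exact hs)
    (by simp [State.setVar_var, State.setVar_arr, hv, hs, hn])
    (by simp [State.setVar_var]) (by simp [State.setVar_var, hv]) ?_).mono ?_
  · rintro x hx p rfl hpW s hs hp hP
    refine wp_splitClasses (le_trans ?_ hW) (hirr x) (hnd x) (hinp x hx) hpW hs hp hP
    exact Nat.add_le_add_left (Finset.sum_le_sum_of_subset (Finset.range_subset_range.2 hx)) 1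
  · simp only [State.setVar_arr, State.setVar_var, if_true]
    refine ⟨fun u v => ?_, fun v => ?_, fun c => ?_, ?_, fun a ha i => hs0 a (by omega) i⟩
    · simp [hs0 1 one_ne_zero]
    · rw [hs0 1 one_ne_zero]; omega
    · rw [hs0 2 two_ne_zero]
    · simp [offset]
  rintro t₁ s₁ ⟨ht₁, hs₁, hn₁, ho₁, hz₁, hP₁⟩
  refine ⟨by omega, ?_⟩
  refine (wp_forVertices (P := Colored nb (s₁.arr 1)) 18 11 hW hdeg ?_ (by exact hs₁)
    (by simp [State.setVar_var, hn₁])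
    (by simp [State.setVar_var, ho₁]) (by simp [State.setVar_var, hz₁]) ?_).mono ?_
  · rintro x hx p rfl hpW s hs hp hP
    exact wp_colorVertex hsymm (hirr x) (hinp x hx) (by omega) hpW hs hp hP
  · simp only [State.setVar_arr, State.setVar_var, if_true]
    have hb := hP₁.blank
    constructor <;> simp [hb]
  rintro t₂ s₂ ⟨ht₂, -, hn₂, -, -, hP₂⟩
  rw [wp_sub]
  refine ⟨by omega, s₁.arr 1, s₂.arr, s₂.var 7, ?_, hP₁.cls_eq_iff, hP₂⟩
  simp [State.output, State.setVar_var, hn₂]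

end RAM

/-! ### The input encoding -/

section Encoding

open RAM

/-- The neighbours of the vertex `x` as numbers; there are none if `n ≤ x`. -/
def neighborList {n : ℕ} (adj : Fin n → List (Fin n)) (x : ℕ) : List ℕ :=
  if h : x < n then (adj ⟨x, h⟩).map Fin.val else []

variable {n : ℕ} {G : SimpleGraph (Fin n)} {adj : Fin n → List (Fin n)}

theorem neighborList_val (adj : Fin n → List (Fin n)) (v : Fin n) :
    neighborList adj v = (adj v).map Fin.val := by
  simp [neighborList]

theorem mem_neighborList (hadj : IsAdjacencyLists G adj) {x y : ℕ} :
    y ∈ neighborList adj x ↔ ∃ u v : Fin n, (u : ℕ) = x ∧ (v : ℕ) = y ∧ G.Adj u v := by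
  constructor
  · intro h
    rw [neighborList] at h
    split_ifs at h with hx
    · obtain ⟨v, hv, rfl⟩ := List.mem_map.1 h
      exact ⟨⟨x, hx⟩, v, rfl, rfl, ((hadj _).2 v).1 hv⟩
    · simp at h
  · rintro ⟨u, v, rfl, rfl, h⟩
    rw [neighborList_val]
    exact List.mem_map_of_mem (((hadj u).2 v).2 h)

theorem val_mem_neighborList (hadj : IsAdjacencyLists G adj) {u v : Fin n} :
    (v : ℕ) ∈ neighborList adj u ↔ G.Adj u v := by
  rw [mem_neighborList hadj]
  constructor
  · rintro ⟨u', v', hu, hv, h⟩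
    rwa [Fin.ext hu, Fin.ext hv] at h
  · exact fun h => ⟨u, v, rfl, rfl, h⟩

theorem nodup_neighborList (hadj : IsAdjacencyLists G adj) (x : ℕ) :
    (neighborList adj x).Nodup := by
  rw [neighborList]
  split_ifs with hx
  · exact (hadj _).1.map Fin.val_injective
  · exact List.nodup_nil

theorem encodeAdjacencyLists_eq (adj : Fin n → List (Fin n)) :
    encodeAdjacencyLists adj = n :: (List.range n).flatMap fun x =>
      (neighborList adj x).length :: neighborList adj x := by
  rw [encodeAdjacencyLists, ← List.map_coe_finRange_eq_range, List.flatMap_map]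
  simp [neighborList_val]

theorem getElem?_flatMap_range (nb : ℕ → List ℕ) {x i : ℕ} (hx : x < n)
    (hi : i < (nb x).length + 1) :
    ((n :: (List.range n).flatMap fun x => (nb x).length :: nb x) : List ℕ)[offset nb x + i]? =
      ((nb x).length :: nb x)[i]? := by
  have hlen : ∀ y, ((List.range y).flatMap fun x => (nb x).length :: nb x).length + 1 =
      offset nb y := by
    intro y
    induction y with
    | zero => simp [offset]
    | succ y ih =>
      rw [List.range_succ, List.flatMap_append, List.length_append, offset_succ, ← ih]
      simp
      omega
  have hsplit : List.range n = List.range x ++ x :: List.range' (x + 1) (n - (x + 1)) := by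
    have : n = x + (n - (x + 1) + 1) := by omega
    rw [List.range_eq_range', List.range_eq_range', ← List.range'_succ]
    conv_lhs => rw [this, ← List.range'_append_1, Nat.zero_add]
  have hx' := hlen x
  rw [hsplit, List.flatMap_append, List.flatMap_cons, ← List.cons_append,
    List.getElem?_append_right (by rw [List.length_cons]; omega), List.length_cons, hx',
    Nat.add_sub_cancel_left, List.getElem?_append_left (by simpa using hi)]

theorem offset_neighborList_eq (hadj : IsAdjacencyLists G adj) :
    offset (neighborList adj) n = 1 + n + 2 * G.edgeSet.ncard := by
  classical
  have hdeg : ∀ v : Fin n, (neighborList adj v).length = G.degree v := by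
    intro v
    rw [neighborList_val, List.length_map, ← List.toFinset_card_of_nodup (hadj v).1,
      ← SimpleGraph.card_neighborFinset_eq_degree]
    congr 1
    ext w
    simp [(hadj v).2 w]
  rw [offset, Finset.sum_range fun y => (neighborList adj y).length + 1, Finset.sum_add_distrib]
  simp only [hdeg]
  rw [G.sum_degrees_eq_twice_card_edges, ← SimpleGraph.coe_edgeFinset, Set.ncard_coe_finset]
  simp
  omega

/-! ### From the final arrays to the strong metric dimension -/

theorem closedNbhd_eq_iff_forall_lt (hadj : IsAdjacencyLists G adj) {u v : Fin n} :
    closedNbhd G u = closedNbhd G v ↔ ∀ y < n,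
      (u : ℕ) ∈ y :: neighborList adj y ↔ (v : ℕ) ∈ y :: neighborList adj y := by
  have hmem : ∀ w y : Fin n, (w : ℕ) ∈ (y : ℕ) :: neighborList adj y ↔ y ∈ closedNbhd G w := by
    intro w y
    rw [List.mem_cons, val_mem_neighborList hadj, mem_closedNbhd, Fin.val_inj, eq_comm, G.adj_comm]
  rw [Set.ext_iff]
  constructor
  · intro h y hy
    exact (hmem u ⟨y, hy⟩).trans ((h _).trans (hmem v ⟨y, hy⟩).symm)
  · intro h y
    exact (hmem u y).symm.trans ((h y y.2).trans (hmem v y))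

/-- The vertices with a colour form a transversal of the classes of true twins, on which the
colouring is first-fit. -/
theorem RAM.Colored.isTwinlessCliqueNum (hG : IsCograph G) (hadj : IsAdjacencyLists G adj)
    {cls : ℕ → ℕ} {arr : ℕ → ℕ → ℕ} {k : ℕ}
    (hcls : ∀ u v, cls u = cls v ↔ ∀ y < n,
      u ∈ y :: neighborList adj y ↔ v ∈ y :: neighborList adj y)
    (h : Colored (neighborList adj) cls n arr k) : IsTwinlessCliqueNum G Set.univ k := by
  have hcls' : ∀ u v : Fin n, cls u = cls v ↔ closedNbhd G u = closedNbhd G v := fun u v => by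
    rw [hcls, closedNbhd_eq_iff_forall_lt hadj]
  have hfit : IsFirstFit G (fun v : Fin n => arr 4 v) k := by
    refine ⟨fun u v huv => h.proper u v ((val_mem_neighborList hadj).2 huv), fun u j hj hju => ?_,
      fun u => h.le u, ?_⟩
    · obtain ⟨w, hw, hwj⟩ := h.fit u j hj hju
      obtain ⟨u', w', hu', rfl, huw⟩ := (mem_neighborList hadj).1 hw
      exact ⟨w', Fin.ext hu' ▸ huw, hwj⟩
    · by_cases hk : k = 0
      · exact Or.inl hk
      · obtain ⟨u, hu⟩ := h.attained.resolve_left hk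
        exact Or.inr ⟨⟨u, h.lt u (hu ▸ hk)⟩, hu⟩
  refine hfit.isTwinlessCliqueNum hG ⟨fun u => ?_, fun s hs t ht hst => ?_⟩
  · obtain ⟨w, hw, hwu⟩ := h.exists_rep u u.2
    exact ⟨⟨w, h.lt w hw⟩, hw, (hcls' ⟨w, h.lt w hw⟩ u).1 hwu⟩
  · exact Fin.ext (h.rep_unique s t hs ht ((hcls' s t).2 hst))

end Encoding

theorem theorem3 :
    -- a linear-time program that computes the strong metric dimension of connected co-graphs
    (∃ (P : RAM.Prog) (c : ℕ),
      ∀ (n : ℕ) (G : SimpleGraph (Fin n)), G.Connected → IsCograph G →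
      ∀ adj : Fin n → List (Fin n), IsAdjacencyLists G adj →
      ∃ (t : ℕ) (s : RAM.State),
        RAM.Runs (c * (n + G.edgeSet.ncard)) P
          (RAM.State.initial (encodeAdjacencyLists adj)) t s ∧
        t ≤ c * (n + G.edgeSet.ncard) ∧
        s.output = strongMetricDim G) ∧
    -- the algorithm on the canonical co-tree
    (∃ c : ℕ,
      ∀ (V : Type*) [Fintype V] (G : SimpleGraph V), G.Connected → IsCograph G →
      (∃ T : CoTree V, T.IsCanonicalCoTreeOf G) ∧
      ∀ T : CoTree V, T.IsCanonicalCoTreeOf G →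
        (smdFromCoTree (Fintype.card V) T).value = strongMetricDim G ∧
        (smdFromCoTree (Fintype.card V) T).steps ≤ c * Fintype.card V ∧
        ∀ S : Set V, IsTwinReduction G S →
          (maxTwinlessClique T).value = (G.induce S).cliqueNum) := by
  refine ⟨⟨RAM.smdProg, 200, ?_⟩, 19, ?_⟩
  · intro n G hconn hG adj hadj
    have hn : 1 ≤ n := by
      obtain ⟨v⟩ := hconn.nonempty
      exact Nat.one_le_of_lt v.2
    -- The input has `1 + n + 2m ≤ 2 (n + m)` words, and each accounts for at most `100` steps.
    have hoff := offset_neighborList_eq hadj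
    have hget : ∀ x < n, ∀ i (h : i < (neighborList adj x).length + 1),
        (encodeAdjacencyLists adj).getD (RAM.offset (neighborList adj) x + i) 0 =
          ((neighborList adj x).length :: neighborList adj x)[i] := by
      intro x hx i hi
      rw [List.getD_eq_getElem?_getD, encodeAdjacencyLists_eq, getElem?_flatMap_range _ hx hi,
        List.getElem?_eq_getElem (by simpa using hi), Option.getD_some]
    obtain ⟨t, s, hrun, ht, cls, arr, k, hout, hcls, hcol⟩ :=
      RAM.wp_smdProg (W := 200 * (n + G.edgeSet.ncard)) (n := n) (nb := neighborList adj)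
        (inp := fun i => (encodeAdjacencyLists adj).getD i 0)
        (s := RAM.State.initial (encodeAdjacencyLists adj)) (by omega) rfl
        (fun x hx => hget x hx 0 (by omega))
        (fun x hx i hi => (congrArg (fun p => (encodeAdjacencyLists adj).getD p 0)
          (show RAM.offset (neighborList adj) x + 1 + i = _ by omega)).trans
            (hget x hx (i + 1) (by omega)))
        (fun u v h => by
          obtain ⟨u', v', hu, hv, h⟩ := (mem_neighborList hadj).1 h
          exact (mem_neighborList hadj).2 ⟨v', u', hv, hu, h.symm⟩)
        (fun x h => by
          obtain ⟨u, v, hu, hv, h⟩ := (mem_neighborList hadj).1 h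
          exact h.ne (Fin.ext (hu.trans hv.symm)))
        (nodup_neighborList hadj) (by simp [RAM.State.initial])
        (fun a ha i => by simp [RAM.State.initial, ha]) (fun y => rfl)
    refine ⟨t, s, hrun, by omega, ?_⟩
    rw [hout, strongMetricDim_eq_card_sub hconn (fun u v => hG.exists_common_neighbor hconn)
      (hcol.isTwinlessCliqueNum hG hadj hcls), Fintype.card_fin]
  · intro V _ G hconn hG
    refine ⟨hG.exists_isCanonicalCoTreeOf, fun T hT => ?_⟩
    have hmu := hT.isTwinlessCliqueNum
    refine ⟨?_, hT.smdFromCoTree_steps_le, fun S hS => ?_⟩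
    · rw [strongMetricDim_eq_card_sub hconn (fun u v => hG.exists_common_neighbor hconn) hmu]
      rfl
    · exact (hS.isTwinTransversal.cliqueNum_eq hmu).symm
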